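/- Let $S=\mathbb{C}[x,y,z]$ and let $C:f=0$ be a reduced curve of degree $d\ge 1$ in $\mathbb{P}^2$, so $f\in S$ is homogeneous of degree $d$ and squarefree. Let $J_f=(f_x,f_y,f_z)$ and $M(f)=S/J_f$. Let $\tau(C)$ be the total Tjurina number of $C$, i.e. the sum over the points $p$ of $\mathbb{P}^2$ of $\dim_{\mathbb{C}}\mathcal{O}_{p}/(g,g_u,g_v)$, where $\mathcal{O}_p$ is the local ring of $\mathbb{P}^2$ at $p$ and $g(u,v)=0$ is a local equation of $C$ in affine coordinates $u,v$. Let $d_1\le\dots\le d_m$ (the exponents of $C$) be the degrees of a minimal homogeneous system of generators $r_1,\dots,r_m$ of the graded $S$-module $\{(a,b,c)\in S^3: af_x+bf_y+cf_z=0\}$, and let $c_1\le\dots\le c_n$ be the degrees of a minimal homogeneous system of generators of the module of relations among $r_1,\dots,r_m$, graded as a submodule of $\bigoplus_{i=1}^m S(1-d-d_i)$. Put $t=t(C)=d_1+d_2+1-d$ (the type of $C$), define $\epsilon_j$ by $c_j=d+d_{j+2}-1+\epsilon_j$, and set $$\tau(d,d_1)_{max}=(d-1)^2-d_1(d-d_1-1),\qquad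 \tau'(d,d_1)_{max}=\tau(d,d_1)_{max}-\binom{2d_1+2-d}{2}.$$ Assume $t\ge 1$. Then $m=n+2$, the generators of the module of relations are linearly independent over $S$ (so that $0\to\bigoplus_{j=1}^{m-2} S(-c_j)\to\bigoplus_{i=1}^m S(1-d-d_i)\to S^3(1-d)\to S$ is exact), and $(\epsilon_1,\dots,\epsilon_n)$ is an ordered partition of $t$: every $\epsilon_j\ge1$ and $\sum_{j=1}^n\epsilon_j=t$. Moreover: (1) $$\tau(d,d_1)_{max}-\tau(C)=\frac{t^2+t}{2}+\frac{\sum_{j=1}^n(\epsilon_j^2-\epsilon_j)}{2}+\sum_{j=1}^n\epsilon_j(d_{j+2}-d_2).$$ Here $t^2+t>0$, $\epsilon_j^2-\epsilon_j\ge0$ and $\epsilon_j(d_{j+2}-d_2)\ge0$ for all $j$. In particular $\tau(C)<\tau(d,d_1)_{max}$. (2) If in addition $2d_1\ge d$, then $$\tau'(d,d_1)_{max}-\tau(C)=\frac{t^2-(t-(d_2-d_1))^2}{2}+\frac{\sum_{j=1}^n(\epsilon_j^2-\epsilon_j)+(d_2-d_1)}{2}+\sum_{j=1}^n\epsilon_j(d_{j+2}-d_2).$$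 Here also $t^2-(t-(d_2-d_1))^2\ge0$ and $d_2-d_1\ge0$. In particular $\tau(C)\le\tau'(d,d_1)_{max}$, and equality holds if and only if $d_1=d_2=\dots=d_m$, $\epsilon_1=\dots=\epsilon_n=1$ and $m=2d_1-d+3$. -/

import Mathlib

noncomputable section

namespace PlaneCurve

open MvPolynomial

/-- The map `S³ → S`, `(a, b, c) ↦ a f_x + b f_y + c f_z`, over `S = ℂ[x, y, z]`. Its image is the
Jacobian ideal of `f`. -/
def jacobianMap (f : MvPolynomial (Fin 3) ℂ) :
    (Fin 3 → MvPolynomial (Fin 3) ℂ) →ₗ[MvPolynomial (Fin 3) ℂ] MvPolynomial (Fin 3) ℂ :=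
  Fintype.linearCombination (MvPolynomial (Fin 3) ℂ) (fun i => pderiv i f)

/-- Let `N` be a submodule of the free graded module `⊕ i, S(-w i)`. The family `g` is a minimal
system of homogeneous generators of `N`, with `g j` of degree `deg j`, listed by increasing
degree. -/
structure IsMinimalGenerators {ι : Type} (N : Submodule (MvPolynomial (Fin 3) ℂ)
    (ι → MvPolynomial (Fin 3) ℂ)) (w : ι → ℕ) {k : ℕ}
    (g : Fin k → ι → MvPolynomial (Fin 3) ℂ) (deg : Fin k → ℕ) : Prop where
  /-- `g j` is homogeneous of degree `deg j`: its `i`-th entry only has monomials of degree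
  `deg j - w i` (and is zero if `deg j < w i`). -/
  homogeneous : ∀ j i a, coeff a (g j i) ≠ 0 → a.degree + w i = deg j
  span_eq : Submodule.span (MvPolynomial (Fin 3) ℂ) (Set.range g) = N
  /-- No generator is superfluous. -/
  minimal : ∀ j, g j ∉ Submodule.span (MvPolynomial (Fin 3) ℂ) (g '' {j}ᶜ)
  monotone : Monotone deg

/-- The generators, with their degrees, in a minimal graded free resolution
`⊕ j, S(-c j) → ⊕ i, S(1 - d - deg i) → S³(1 - d) → S` of the Jacobian algebra `M(f) = S / J_f`
of a form `f` of degree `d`. The number of modules `S(-c j)` is not prescribed, and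
neither is the injectivity of the leftmost map. -/
structure MinimalResolution (f : MvPolynomial (Fin 3) ℂ) (d : ℕ) where
  /-- the number of minimal first syzygies of `f_x, f_y, f_z` -/
  m : ℕ
  /-- the number of minimal second syzygies -/
  n : ℕ
  /-- the minimal first syzygies -/
  firstSyz : Fin m → Fin 3 → MvPolynomial (Fin 3) ℂ
  /-- the degrees of the entries of the first syzygies -/
  deg : Fin m → ℕ
  isMinimal_first :
    IsMinimalGenerators (LinearMap.ker (jacobianMap f)) (fun _ => 0) firstSyz deg
  /-- the minimal second syzygies -/
  secondSyz : Fin n → Fin m → MvPolynomial (Fin 3) ℂ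
  /-- the degrees of the second syzygies, as elements of `⊕ i, S(1 - d - deg i)` -/
  c : Fin n → ℕ
  isMinimal_second :
    IsMinimalGenerators
      (LinearMap.ker (Fintype.linearCombination (MvPolynomial (Fin 3) ℂ) firstSyz))
      (fun i => d - 1 + deg i) secondSyz c

namespace MinimalResolution

variable {f : MvPolynomial (Fin 3) ℂ} {d : ℕ} (R : MinimalResolution f d)

/-- The exponents `d_1 ≤ d_2 ≤ ⋯ ≤ d_m` of the curve, numbered from `1` (and `0` outside the
range `1, …, m`). -/
def exponent (k : ℕ) : ℕ := if h : 1 ≤ k ∧ k ≤ R.m then R.deg ⟨k - 1, by omega⟩ else 0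

/-- The degrees `c_1 ≤ ⋯ ≤ c_n` of the second syzygies, numbered from `1` (and `0` outside the
range `1, …, n`). -/
def secondDegree (j : ℕ) : ℕ := if h : 1 ≤ j ∧ j ≤ R.n then R.c ⟨j - 1, by omega⟩ else 0

/-- The type `t(C) = d_1 + d_2 + 1 - d`. -/
def curveType : ℤ := (R.exponent 1 : ℤ) + R.exponent 2 + 1 - d

/-- The integers `ε_j` defined by `c_j = d + d_{j+2} - 1 + ε_j`. -/
def eps (j : ℕ) : ℤ := (R.secondDegree j : ℤ) - ((d : ℤ) + R.exponent (j + 2) - 1)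

end MinimalResolution

instance isPrime_ker_eval (a : Fin 2 → ℂ) :
    (RingHom.ker (eval a : MvPolynomial (Fin 2) ℂ →+* ℂ)).IsPrime := RingHom.ker_isPrime _

/-- The local Tjurina number at `a ∈ ℂ²` of the affine curve `g = 0`: the dimension of
`O / (g, g_u, g_v)`, where `O` is the local ring of the affine plane at `a`. -/
def localTjurina (g : MvPolynomial (Fin 2) ℂ) (a : Fin 2 → ℂ) : ℕ :=
  Module.finrank ℂ
    (Localization.AtPrime (RingHom.ker (eval a : MvPolynomial (Fin 2) ℂ →+* ℂ)) ⧸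
      (Ideal.span {g, pderiv 0 g, pderiv 1 g}).map
        (algebraMap (MvPolynomial (Fin 2) ℂ) (Localization.AtPrime (RingHom.ker (eval a : MvPolynomial (Fin 2) ℂ →+* ℂ)))))

/-- Setting the `i`-th homogeneous coordinate equal to `1`. -/
def dehomogenize (i : Fin 3) : MvPolynomial (Fin 3) ℂ →ₐ[ℂ] MvPolynomial (Fin 2) ℂ :=
  aeval (i.insertNth (α := fun _ => MvPolynomial (Fin 2) ℂ) 1 X)

/-- The index of a nonzero homogeneous coordinate of a point of the projective plane. -/
def chart (p : Projectivization ℂ (Fin 3 → ℂ)) : Fin 3 :=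
  Classical.choose (Function.ne_iff.mp p.rep_nonzero)

/-- The affine coordinates of `p` in the chart where the coordinate with index `chart p` is `1`. -/
def affineCoords (p : Projectivization ℂ (Fin 3 → ℂ)) : Fin 2 → ℂ :=
  fun j => p.rep ((chart p).succAbove j) / p.rep (chart p)

/-- The total Tjurina number `τ(C)` of the curve `C : f = 0` in the projective plane: the sum of
the local Tjurina numbers. Points off `C` and smooth points of `C` contribute `0`. -/
def totalTjurina (f : MvPolynomial (Fin 3) ℂ) : ℕ :=
  ∑ᶠ p : Projectivization ℂ (Fin 3 → ℂ), localTjurina (dehomogenize (chart p) f) (affineCoords p)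

/-- `τ(d, d₁)_max = (d - 1)² - d₁ (d - d₁ - 1)`. -/
def tauMax (d d₁ : ℕ) : ℤ := ((d : ℤ) - 1) ^ 2 - (d₁ : ℤ) * ((d : ℤ) - d₁ - 1)

/-- `τ'(d, d₁)_max = τ(d, d₁)_max - binom (2 d₁ + 2 - d) 2`, used for `2 d₁ ≥ d` only. -/
def tauMax' (d d₁ : ℕ) : ℤ := tauMax d d₁ - ((2 * d₁ + 2 - d).choose 2 : ℕ)

end PlaneCurve

end

/-! The proof computes the Hilbert polynomial of `S / J_f` twice.

Algebraically, relations among minimal generators have no constant terms, so a chase through the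
Koszul complex on `x, y, z` makes the second syzygies independent (`ker_eq_bot_of_minimal`). In
large degree the resolution then expresses the Hilbert function as an alternating sum of binomials
in the `d_i` and `c_j` (`hilbert_jacobianIdeal`).

Geometrically, this function is eventually the constant `τ(C)` (`exists_hilbert_eq_totalTjurina`).
As `f` is squarefree, `J_f` contains two coprime forms of degree `d - 1`, so its projective zero set
is finite. For a linear form `ℓ` missing that set, multiplication by `ℓ` is eventually bijective on
graded pieces, and the constant is the length of the Jacobian scheme on the plane `ℓ = 1`. The
Chinese remainder theorem splits it into local lengths, and Euler's formula identifies these with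
the local Tjurina numbers.

Comparing coefficients of a polynomial of degree at most 2 (`hilbert_polynomial_relations`) gives `m
= n + 2`, then `∑ ε_j = t`, then a formula for `2τ(C)`. Substituting `c_j = d - 1 + d_{j+2} + ε_j`
turns the last one into formula (1). Formula (2) follows because the binomial is `(s² + s) / 2` with
`s = 2d_1 + 1 - d = t - (d_2 - d_1)`.

Positivity of `ε_j` (`lt_c`) is a rank argument: if `c_j ≤ d - 1 + d_{j+2}`, minimality forces the
first `j` second syzygies to live in the first `j + 1` coordinates. With the first two unit vectors,
they would be `j + 2` independent vectors there, since `r_1` and `r_2` are independent. -/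

namespace PlaneCurve

open MvPolynomial Filter

attribute [local instance] MvPolynomial.gradedAlgebra

noncomputable section

/-- The coordinate ring `S = ℂ[x, y, z]` of the projective plane. -/
abbrev S := MvPolynomial (Fin 3) ℂ


/-! ### Graded components in shifted free modules -/

lemma coe_decompose (n : ℕ) (u : S) :
    (DirectSum.decompose (homogeneousSubmodule (Fin 3) ℂ) u n : S) = homogeneousComponent n u :=
  decomposition.decompose'_apply u n

/-- The component of degree `D` of an element of `S(-w)`. -/
def shiftedComponent (D w : ℕ) : S →ₗ[ℂ] S :=
  if w ≤ D then homogeneousComponent (D - w) else 0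

lemma shiftedComponent_of_le {D w : ℕ} (h : w ≤ D) (u : S) :
    shiftedComponent D w u = homogeneousComponent (D - w) u := by
  simp [shiftedComponent, h]

/-- A nonzero `g` is a form of degree `e - w`. The cases `D < w` and `D < e` are separated because
truncated subtraction would pick out constant terms there. -/
lemma shiftedComponent_mul {D w e : ℕ} {g : S} (hg : ∀ a, coeff a g ≠ 0 → a.degree + w = e)
    (u : S) : shiftedComponent D w (u * g) = shiftedComponent D e u * g := by
  by_cases h0 : g = 0
  · simp [h0]
  obtain ⟨a, ha⟩ := ne_zero_iff.mp h0
  have hwe : w ≤ e := by have := hg a ha; omega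
  have hgm : g ∈ homogeneousSubmodule (Fin 3) ℂ (e - w) := by
    rw [mem_homogeneousSubmodule]
    intro b hb
    have := hg b hb
    have h1 : b.degree = Finsupp.weight (fun _ => 1) b :=
      DFunLike.congr_fun Finsupp.degree_eq_weight_one b
    change Finsupp.weight (fun _ => 1) b = e - w
    omega
  unfold shiftedComponent
  by_cases h1 : w ≤ D
  · by_cases h2 : e ≤ D
    · rw [if_pos h1, if_pos h2, ← coe_decompose, ← coe_decompose,
        DirectSum.coe_decompose_mul_of_right_mem_of_le _ hgm (by omega)]
      rw [show D - w - (e - w) = D - e by omega]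
    · rw [if_pos h1, if_neg h2, ← coe_decompose,
        DirectSum.coe_decompose_mul_of_right_mem_of_not_le _ hgm (by omega)]
      simp
  · rw [if_neg h1, if_neg (by omega)]
    simp

lemma shiftedComponent_linearCombination {ι κ : Type} [Fintype κ] {w : ι → ℕ} {e : κ → ℕ}
    {g : κ → ι → S} (hg : ∀ j i a, coeff a (g j i) ≠ 0 → a.degree + w i = e j) (D : ℕ)
    (u : κ → S) (i : ι) :
    shiftedComponent D (w i) (Fintype.linearCombination S g u i) =
      Fintype.linearCombination S g (fun j => shiftedComponent D (e j) (u j)) i := by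
  simp only [Fintype.linearCombination_apply, Finset.sum_apply, Pi.smul_apply, smul_eq_mul,
    map_sum]
  exact Finset.sum_congr rfl fun j _ => shiftedComponent_mul (hg j i) _

/-! ### Minimality: relations among minimal generators have no constant terms -/

/-- In the part of the relation of degree `deg j`, the coefficient of `g j` is the constant term of
`u j`. Were it nonzero, it could be inverted and `g j` would be superfluous. -/
lemma IsMinimalGenerators.constantCoeff_eq_zero {ι : Type} {N : Submodule S (ι → S)} {w : ι → ℕ}
    {k : ℕ} {g : Fin k → ι → S} {deg : Fin k → ℕ} (h : IsMinimalGenerators N w g deg)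
    {u : Fin k → S} (hu : Fintype.linearCombination S g u = 0) (j : Fin k) :
    constantCoeff (u j) = 0 := by
  by_contra hc
  have h1 : Fintype.linearCombination S g (fun i => shiftedComponent (deg j) (deg i) (u i)) = 0 := by
    ext1 i
    rw [← shiftedComponent_linearCombination h.homogeneous, hu]
    simp
  have h2 : shiftedComponent (deg j) (deg j) (u j) = C (constantCoeff (u j)) := by
    rw [shiftedComponent_of_le le_rfl, Nat.sub_self, homogeneousComponent_zero]
    rfl
  rw [Fintype.linearCombination_apply, ← Finset.add_sum_erase _ _ (Finset.mem_univ j), h2] at h1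
  refine h.minimal j ?_
  have h3 : g j = (C (constantCoeff (u j))⁻¹ : S) • -∑ i ∈ Finset.univ.erase j,
      shiftedComponent (deg j) (deg i) (u i) • g i := by
    rw [← eq_neg_of_add_eq_zero_left h1, smul_smul, ← C_mul, inv_mul_cancel₀ hc, C_1, one_smul]
  rw [h3]
  refine Submodule.smul_mem _ _ (Submodule.neg_mem _ (Submodule.sum_mem _ fun i hi => ?_))
  exact Submodule.smul_mem _ _ (Submodule.subset_span
    (Set.mem_image_of_mem _ (by simpa using Finset.ne_of_mem_erase hi)))

/-! ### Exactness of the Koszul complex on the coordinates -/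

/-- Modulo `(x, y)`, a polynomial is congruent to its value at `x = y = 0`. -/
lemma exists_of_eval_eq_zero {p : S}
    (hp : aeval (fun i : Fin 3 => if i = 2 then (X 2 : S) else 0) p = 0) :
    ∃ q r, p = X 0 * q + X 1 * r := by
  have h : (Ideal.Quotient.mkₐ ℂ (Ideal.span {(X 0 : S), X 1})).comp
      (aeval (fun i : Fin 3 => if i = 2 then (X 2 : S) else 0)) = Ideal.Quotient.mkₐ ℂ _ := by
    ext i
    fin_cases i
    · have : (X 0 : S) ∈ Ideal.span {(X 0 : S), X 1} := Ideal.subset_span (by simp)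
      simpa using (Ideal.Quotient.eq_zero_iff_mem.mpr this).symm
    · have : (X 1 : S) ∈ Ideal.span {(X 0 : S), X 1} := Ideal.subset_span (by simp)
      simpa using (Ideal.Quotient.eq_zero_iff_mem.mpr this).symm
    · simp
  have h2 := DFunLike.congr_fun h p
  rw [AlgHom.comp_apply, hp, map_zero] at h2
  obtain ⟨q, r, h3⟩ := Ideal.mem_span_pair.mp (Ideal.Quotient.eq_zero_iff_mem.mp h2.symm)
  exact ⟨q, r, by rw [← h3]; ring⟩

lemma koszul_pair {a b : S} (h : X 0 * a + X 1 * b = 0) : ∃ p, a = X 1 * p ∧ b = -(X 0 * p) := by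
  have hdvd : (X 1 : S) ∣ X 0 * a := ⟨-b, by linear_combination h⟩
  have hp : Prime (X 1 : S) := X_prime
  rcases hp.dvd_or_dvd hdvd with h1 | ⟨p, rfl⟩
  · rw [X_dvd_X] at h1
    simp at h1
  · refine ⟨p, rfl, ?_⟩
    have hX : (X 1 : S) ≠ 0 := X_ne_zero 1
    apply mul_left_cancel₀ hX
    linear_combination h

/-- Setting `x = y = 0` shows `c ∈ (x, y)`. Subtracting Koszul relations removes `c` and leaves a
relation between `x` and `y` only. -/
lemma koszul {a b c : S} (h : X 0 * a + X 1 * b + X 2 * c = 0) :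
    ∃ p q r, a = X 1 * p + X 2 * q ∧ b = -(X 0 * p) + X 2 * r ∧ c = -(X 0 * q) - X 1 * r := by
  have h1 : aeval (fun i : Fin 3 => if i = 2 then (X 2 : S) else 0) c = 0 := by
    have := congrArg (aeval (fun i : Fin 3 => if i = 2 then (X 2 : S) else 0)) h
    simpa [X_ne_zero] using this
  obtain ⟨q, r, rfl⟩ := exists_of_eval_eq_zero h1
  obtain ⟨p, hp1, hp2⟩ := koszul_pair (a := a + X 2 * q) (b := b + X 2 * r)
    (by linear_combination h)
  exact ⟨p, -q, -r, by linear_combination hp1, by linear_combination hp2, by ring⟩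

lemma koszul_pi {ι : Type} {a b c : ι → S}
    (h : (X 0 : S) • a + (X 1 : S) • b + (X 2 : S) • c = 0) :
    ∃ p q r : ι → S, a = (X 1 : S) • p + (X 2 : S) • q ∧ b = -((X 0 : S) • p) + (X 2 : S) • r ∧
      c = -((X 0 : S) • q) - (X 1 : S) • r := by
  have h' : ∀ i, X 0 * a i + X 1 * b i + X 2 * c i = 0 := fun i => congrFun h i
  choose p q r h1 h2 h3 using fun i => koszul (h' i)
  exact ⟨p, q, r, funext h1, funext h2, funext h3⟩

/-- If `y p + z q = 0` and `-x p + z r = 0` hold in a free module, then `(p, q, r)` is a multiple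
of `(z, -y, x)`. -/
lemma koszul_top_pi {ι : Type} {p q r : ι → S}
    (h1 : (X 1 : S) • p + (X 2 : S) • q = 0) (h2 : -((X 0 : S) • p) + (X 2 : S) • r = 0) :
    ∃ e : ι → S, p = (X 2 : S) • e ∧ q = -((X 1 : S) • e) ∧ r = (X 0 : S) • e := by
  have hdvd : ∀ i, (X 2 : S) ∣ p i := fun i => by
    have hd : (X 2 : S) ∣ X 1 * p i := ⟨-q i, by
      have : X 1 * p i + X 2 * q i = 0 := congrFun h1 i
      linear_combination this⟩
    rcases X_prime.dvd_or_dvd hd with h | h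
    · rw [X_dvd_X] at h
      simp at h
    · exact h
  choose e he using hdvd
  have hX : (X 2 : S) ≠ 0 := X_ne_zero 2
  refine ⟨e, funext he, funext fun i => mul_left_cancel₀ hX ?_,
    funext fun i => mul_left_cancel₀ hX ?_⟩
  · have : X 1 * p i + X 2 * q i = 0 := congrFun h1 i
    rw [he i] at this
    simp only [Pi.neg_apply, Pi.smul_apply, smul_eq_mul]
    linear_combination this
  · have : -(X 0 * p i) + X 2 * r i = 0 := congrFun h2 i
    rw [he i] at this
    simp only [Pi.smul_apply, smul_eq_mul]
    linear_combination this

/-- Exactness propagates the relation `ker G ⊆ 𝔪 Sⁿ` to `ker G = 𝔪 ker G` at the third step of a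
resolution of an ideal of `S`. -/
lemma exists_ker_eq_smul {α ι κ : Type} {φ : (α → S) →ₗ[S] S} {F : (ι → S) →ₗ[S] (α → S)}
    {G : (κ → S) →ₗ[S] (ι → S)} (hF : LinearMap.range F = LinearMap.ker φ)
    (hG : LinearMap.range G = LinearMap.ker F) {a b c : κ → S}
    (h : G ((X 0 : S) • a + (X 1 : S) • b + (X 2 : S) • c) = 0) :
    ∃ a' b' c' : κ → S, G a' = 0 ∧ G b' = 0 ∧ G c' = 0 ∧
      (X 0 : S) • a + (X 1 : S) • b + (X 2 : S) • c =
        (X 0 : S) • a' + (X 1 : S) • b' + (X 2 : S) • c' := by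
  have hFG : ∀ v, F (G v) = 0 := fun v => by
    have : G v ∈ LinearMap.ker F := hG ▸ LinearMap.mem_range_self G v
    exact this
  simp only [map_add, map_smul] at h
  -- Double chase: `G a, G b, G c` form a Koszul cycle with primitive `p, q, r`. The images of `p,
  -- q, r` under `F` form a cycle one step higher, hence come from a single `e`, and `φ e = 0` lifts
  -- `e` to some `s`.
  obtain ⟨p, q, r, hp, hq, hr⟩ := koszul_pi h
  have e1 := congrArg F hp
  have e2 := congrArg F hq
  simp only [map_add, map_smul, map_neg, hFG] at e1 e2
  obtain ⟨e, he1, he2, he3⟩ := koszul_top_pi e1.symm e2.symm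
  have heφ : e ∈ LinearMap.range F := by
    rw [hF, LinearMap.mem_ker]
    have h0 : φ (F p) = 0 := by
      have : F p ∈ LinearMap.ker φ := hF ▸ LinearMap.mem_range_self F p
      exact this
    rw [he1, map_smul, smul_eq_mul] at h0
    exact (mul_eq_zero.mp h0).resolve_left (X_ne_zero 2)
  obtain ⟨s, rfl⟩ := heφ
  have hp' : p - (X 2 : S) • s ∈ LinearMap.range G := by
    rw [hG, LinearMap.mem_ker, map_sub, map_smul, he1, sub_self]
  have hq' : q + (X 1 : S) • s ∈ LinearMap.range G := by
    rw [hG, LinearMap.mem_ker, map_add, map_smul, he2, neg_add_cancel]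
  have hr' : r - (X 0 : S) • s ∈ LinearMap.range G := by
    rw [hG, LinearMap.mem_ker, map_sub, map_smul, he3, sub_self]
  obtain ⟨p', hp'⟩ := hp'
  obtain ⟨q', hq'⟩ := hq'
  obtain ⟨r', hr'⟩ := hr'
  -- The correction is a Koszul boundary, so the combination with `x, y, z` is unchanged.
  refine ⟨a - (X 1 : S) • p' - (X 2 : S) • q', b + (X 0 : S) • p' - (X 2 : S) • r',
    c + (X 0 : S) • q' + (X 1 : S) • r', ?_, ?_, ?_, ?_⟩
  · simp only [map_sub, map_smul, hp', hq', hp]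
    module
  · simp only [map_sub, map_add, map_smul, hp', hr', hq]
    module
  · simp only [map_add, map_smul, hq', hr', hr]
    module
  · module

lemma exists_eq_smul_add {κ : Type} {u : κ → S} (h : ∀ j, constantCoeff (u j) = 0) :
    ∃ a b c : κ → S, u = (X 0 : S) • a + (X 1 : S) • b + (X 2 : S) • c := by
  have key : ∀ j, ∃ a : Fin 3 → S, ∑ i, a i * X i = u j := fun j => by
    have : u j ∈ idealOfVars (Fin 3) ℂ := by
      rw [← pow_one (idealOfVars (Fin 3) ℂ), mem_pow_idealOfVars_iff']
      intro x hx
      have : x = 0 := (Finsupp.degree_eq_zero_iff x).mp (Nat.lt_one_iff.mp hx)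
      rw [this]
      exact h j
    exact Ideal.mem_span_range_iff_exists_fun.mp this
  choose a ha using key
  refine ⟨fun j => a j 0, fun j => a j 1, fun j => a j 2, funext fun j => ?_⟩
  rw [← ha j, Fin.sum_univ_three]
  simp only [Pi.add_apply, Pi.smul_apply, smul_eq_mul]
  ring

/-- Hilbert's syzygy theorem for ideals of `ℂ[x, y, z]`: minimal second syzygies satisfy no
relations. -/
lemma ker_eq_bot_of_minimal {α ι κ : Type} {φ : (α → S) →ₗ[S] S} {F : (ι → S) →ₗ[S] (α → S)}
    {G : (κ → S) →ₗ[S] (ι → S)} (hF : LinearMap.range F = LinearMap.ker φ)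
    (hG : LinearMap.range G = LinearMap.ker F)
    (hmin : ∀ u, G u = 0 → ∀ j, constantCoeff (u j) = 0) : LinearMap.ker G = ⊥ := by
  -- By `exists_ker_eq_smul` the kernel equals `𝔪` times itself, so its entries lie in every power
  -- of `𝔪`, and these meet in zero.
  have key : ∀ N, ∀ u, G u = 0 → ∀ j, u j ∈ idealOfVars (Fin 3) ℂ ^ N := by
    intro N
    induction N with
    | zero => simp
    | succ N ih =>
      intro u hu j
      obtain ⟨a, b, c, rfl⟩ := exists_eq_smul_add (hmin u hu)
      obtain ⟨a', b', c', ha, hb, hc, h⟩ := exists_ker_eq_smul hF hG hu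
      rw [h, pow_succ']
      have hX : ∀ i, (X i : S) ∈ idealOfVars (Fin 3) ℂ := fun i =>
        Ideal.subset_span (Set.mem_range_self i)
      exact Ideal.add_mem _ (Ideal.add_mem _ (Ideal.mul_mem_mul (hX 0) (ih a' ha j))
        (Ideal.mul_mem_mul (hX 1) (ih b' hb j))) (Ideal.mul_mem_mul (hX 2) (ih c' hc j))
  rw [Submodule.eq_bot_iff]
  intro u hu
  ext j x
  exact (mem_pow_idealOfVars_iff' _ _).mp (key (x.degree + 1) u hu j) x (Nat.lt_succ_self _)

/-! ### The maps of the resolution and the independence of its syzygies. -/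

namespace MinimalResolution

variable {f : S} {d : ℕ} (R : MinimalResolution f d)

/-- The map `⊕ i, S(1 - d - deg i) → S³(1 - d)` of the resolution. -/
def firstMap : (Fin R.m → S) →ₗ[S] (Fin 3 → S) := Fintype.linearCombination S R.firstSyz

/-- The map `⊕ j, S(-c j) → ⊕ i, S(1 - d - deg i)` of the resolution. -/
def secondMap : (Fin R.n → S) →ₗ[S] (Fin R.m → S) := Fintype.linearCombination S R.secondSyz

lemma range_firstMap : LinearMap.range R.firstMap = LinearMap.ker (jacobianMap f) := by
  rw [firstMap, Fintype.range_linearCombination, R.isMinimal_first.span_eq]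

lemma range_secondMap : LinearMap.range R.secondMap = LinearMap.ker R.firstMap := by
  rw [secondMap, Fintype.range_linearCombination, R.isMinimal_second.span_eq, firstMap]

lemma ker_secondMap : LinearMap.ker R.secondMap = ⊥ :=
  ker_eq_bot_of_minimal R.range_firstMap R.range_secondMap
    fun _ hu j => R.isMinimal_second.constantCoeff_eq_zero hu j

lemma linearIndependent_secondSyz : LinearIndependent S R.secondSyz :=
  Fintype.linearIndependent_iff.mpr fun u hu => by
    have : u ∈ LinearMap.ker R.secondMap := by
      rw [LinearMap.mem_ker, secondMap, Fintype.linearCombination_apply, hu]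
    rw [ker_secondMap, Submodule.mem_bot] at this
    exact congrFun this

lemma constantCoeff_eq_zero_of_firstMap {u : Fin R.m → S} (hu : R.firstMap u = 0) (j : Fin R.m) :
    constantCoeff (u j) = 0 :=
  R.isMinimal_first.constantCoeff_eq_zero hu j

lemma firstMap_single (i : Fin R.m) (a : S) : R.firstMap (Pi.single i a) = a • R.firstSyz i := by
  rw [firstMap, Fintype.linearCombination_apply_single]

/-- Two different minimal first syzygies are linearly independent. -/
lemma eq_zero_of_smul_add_smul {i j : Fin R.m} (hij : i ≠ j) {α β : S}
    (h : α • R.firstSyz i + β • R.firstSyz j = 0) : α = 0 ∧ β = 0 := by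
  by_contra hne
  -- With the common factor removed, coprimality makes `b` divide every entry of the `i`-th syzygy.
  obtain ⟨a, b, c, hab, rfl, rfl⟩ : ∃ a b c : S, IsRelPrime a b ∧ c * a = α ∧ c * b = β := by
    by_cases hα : α = 0
    · exact UniqueFactorizationMonoid.exists_reduced_factors' α β fun hβ => hne ⟨hα, hβ⟩
    · exact UniqueFactorizationMonoid.exists_reduced_factors α hα β
  have hc : c ≠ 0 := by
    rintro rfl
    simp at hne
  have h' : a • R.firstSyz i + b • R.firstSyz j = 0 := by
    have : c • (a • R.firstSyz i + b • R.firstSyz j) = 0 := by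
      rw [smul_add, smul_smul, smul_smul, h]
    exact (smul_eq_zero.mp this).resolve_left hc
  have hrel : R.firstMap (Pi.single i a + Pi.single j b) = 0 := by
    rw [map_add, firstMap_single, firstMap_single, h']
  have ha0 : constantCoeff a = 0 := by
    simpa [hij] using R.constantCoeff_eq_zero_of_firstMap hrel i
  have hb0 : constantCoeff b = 0 := by
    simpa [hij] using R.constantCoeff_eq_zero_of_firstMap hrel j
  have hk : ∀ k, a * R.firstSyz i k + b * R.firstSyz j k = 0 := fun k => congrFun h' k
  have hdvd : ∀ k, b ∣ R.firstSyz i k := fun k =>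
    hab.symm.dvd_of_dvd_mul_left ⟨-R.firstSyz j k, by linear_combination hk k⟩
  choose s hs using hdvd
  have hsi : R.firstSyz i = b • s := funext hs
  have hb : b ≠ 0 := by
    rintro rfl
    have : R.firstMap (Pi.single i 1) = 0 := by
      rw [firstMap_single, hsi, zero_smul, smul_zero]
    simpa using R.constantCoeff_eq_zero_of_firstMap this i
  have hker : R.firstSyz i ∈ LinearMap.ker (jacobianMap f) := by
    rw [← R.isMinimal_first.span_eq]
    exact Submodule.subset_span (Set.mem_range_self i)
  -- The quotient by `b` is again a syzygy. Since `b` has no constant term, writing it in the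
  -- generators gives a relation with constant term 1 at `i`, against minimality.
  have hsk : s ∈ LinearMap.range R.firstMap := by
    rw [range_firstMap]
    rw [hsi, LinearMap.mem_ker, map_smul] at hker
    exact (smul_eq_zero.mp hker).resolve_left hb
  obtain ⟨u, rfl⟩ := hsk
  have hu : R.firstMap (Pi.single i 1 - b • u) = 0 := by
    rw [map_sub, firstMap_single, map_smul, one_smul, hsi, sub_self]
  simpa [hb0] using R.constantCoeff_eq_zero_of_firstMap hu i

end MinimalResolution

/-! ### Graded pieces and the Hilbert function -/

/-- The forms of degree `k` in three variables. -/
abbrev forms (k : ℕ) : Submodule ℂ S := homogeneousSubmodule (Fin 3) ℂ k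

lemma card_degree_eq (k : ℕ) : Nat.card {a : Fin 3 →₀ ℕ | a.degree = k} = (k + 2).choose 2 := by
  have h : {a : Fin 3 →₀ ℕ | a.degree = k} =
      ((Finset.univ : Finset (Fin 3)).finsuppAntidiag k : Set (Fin 3 →₀ ℕ)) := by
    ext a
    simp [Finsupp.degree_eq_sum]
  rw [Nat.card_coe_set_eq, h, Set.ncard_coe_finset, Finset.card_finsuppAntidiag_nat_eq_choose]
  simp only [Finset.card_univ, Fintype.card_fin]
  rw [show 3 + k - 1 = k + 2 by omega, Nat.choose_symm_add]

instance finite_forms (k : ℕ) : Module.Finite ℂ (forms k) :=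
  Module.Finite.iff_fg.mpr (homogeneousSubmodule_fg (Fin 3) ℂ k)

lemma finrank_forms (k : ℕ) : Module.finrank ℂ (forms k) = (k + 2).choose 2 := by
  rw [forms, homogeneousSubmodule_eq_finsupp_supported]
  exact (Module.finrank_eq_nat_card_basis (basisRestrictSupport ℂ {a : Fin 3 →₀ ℕ | a.degree = k})).trans
    (card_degree_eq k)

lemma finrank_map_add_finrank_inf_ker {K V W : Type*} [Field K] [AddCommGroup V] [Module K V]
    [AddCommGroup W] [Module K W] (φ : V →ₗ[K] W) (E : Submodule K V) [Module.Finite K E] :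
    Module.finrank K (E.map φ) + Module.finrank K (E ⊓ LinearMap.ker φ : Submodule K V) =
      Module.finrank K E := by
  have h := (φ.domRestrict E).finrank_range_add_finrank_ker
  rw [LinearMap.range_domRestrict, LinearMap.ker_domRestrict] at h
  rw [← h, ← Submodule.map_comap_subtype,
    (Submodule.equivMapOfInjective E.subtype E.subtype_injective _).finrank_eq]

/-- The homogeneous elements of degree `D` in the free module `⊕ i, S(-w i)`, for `D` not smaller
than the shifts `w i`. -/
def gradedPiece {ι : Type} (D : ℕ) (w : ι → ℕ) : Submodule ℂ (ι → S) :=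
  Submodule.pi Set.univ fun i => forms (D - w i)

lemma mem_gradedPiece {ι : Type} {D : ℕ} {w : ι → ℕ} {u : ι → S} :
    u ∈ gradedPiece D w ↔ ∀ i, u i ∈ forms (D - w i) := by
  simp [gradedPiece, Submodule.mem_pi]

/-- A graded piece of a free module is a product of spaces of forms. -/
def gradedPieceEquiv {ι : Type} (D : ℕ) (w : ι → ℕ) :
    gradedPiece D w ≃ₗ[ℂ] ∀ i, forms (D - w i) where
  toFun u i := ⟨u.1 i, mem_gradedPiece.mp u.2 i⟩
  invFun u := ⟨fun i => u i, mem_gradedPiece.mpr fun i => (u i).2⟩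
  map_add' _ _ := rfl
  map_smul' _ _ := rfl
  left_inv _ := rfl
  right_inv _ := rfl

instance finite_gradedPiece {ι : Type} [Finite ι] (D : ℕ) (w : ι → ℕ) :
    Module.Finite ℂ (gradedPiece D w) :=
  Module.Finite.equiv (gradedPieceEquiv D w).symm

lemma finrank_gradedPiece {ι : Type} [Fintype ι] (D : ℕ) (w : ι → ℕ) :
    Module.finrank ℂ (gradedPiece D w) = ∑ i, (D - w i + 2).choose 2 := by
  rw [(gradedPieceEquiv D w).finrank_eq, Module.finrank_pi_fintype]
  simp only [finrank_forms]

lemma shiftedComponent_mem (D w : ℕ) (u : S) : shiftedComponent D w u ∈ forms (D - w) := by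
  unfold shiftedComponent
  split_ifs
  · exact homogeneousComponent_mem _ _
  · exact Submodule.zero_mem _

lemma shiftedComponent_of_mem {D w : ℕ} (h : w ≤ D) {u : S} (hu : u ∈ forms (D - w)) :
    shiftedComponent D w u = u := by
  rw [shiftedComponent_of_le h, homogeneousComponent_of_mem hu, if_pos rfl]

lemma mem_forms_of_coeff {D w e : ℕ} (he : e ≤ D) {g u : S}
    (hg : ∀ a, coeff a g ≠ 0 → a.degree + w = e) (hu : u ∈ forms (D - e)) :
    u * g ∈ forms (D - w) := by
  rw [← shiftedComponent_of_mem he hu, ← shiftedComponent_mul hg]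
  exact shiftedComponent_mem _ _ _

/-- The map is graded, so any preimage of a homogeneous element can be replaced by its component of
degree `D`. -/
lemma gradedPiece_inf_range {ι κ : Type} [Fintype κ] {w : ι → ℕ} {e : κ → ℕ}
    {g : κ → ι → S} (hg : ∀ j i a, coeff a (g j i) ≠ 0 → a.degree + w i = e j) {D : ℕ}
    (hw : ∀ i, w i ≤ D) (he : ∀ j, e j ≤ D) :
    gradedPiece D w ⊓ (LinearMap.range (Fintype.linearCombination S g)).restrictScalars ℂ =
      (gradedPiece D e).map ((Fintype.linearCombination S g).restrictScalars ℂ) := by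
  apply le_antisymm
  · rintro _ ⟨hv, u, rfl⟩
    refine ⟨fun j => shiftedComponent D (e j) (u j),
      mem_gradedPiece.mpr fun j => shiftedComponent_mem _ _ _, ?_⟩
    ext1 i
    rw [LinearMap.restrictScalars_apply, ← shiftedComponent_linearCombination hg,
      shiftedComponent_of_mem (hw i) (mem_gradedPiece.mp hv i)]
  · rintro _ ⟨u, hu, rfl⟩
    refine ⟨mem_gradedPiece.mpr fun i => ?_, u, rfl⟩
    simp only [LinearMap.restrictScalars_apply, Fintype.linearCombination_apply, Finset.sum_apply,
      Pi.smul_apply, smul_eq_mul]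
    exact Submodule.sum_mem _ fun j _ =>
      mem_forms_of_coeff (he j) (hg j i) (mem_gradedPiece.mp hu j)

lemma degree_of_coeff_ne_zero {h : S} {e : ℕ} (hh : h ∈ forms e) (a : Fin 3 →₀ ℕ)
    (ha : coeff a h ≠ 0) : a.degree + 0 = e := by
  have h1 : a.degree = Finsupp.weight (fun _ => 1) a :=
    DFunLike.congr_fun Finsupp.degree_eq_weight_one a
  have h2 : Finsupp.weight (fun _ => 1) a = e := hh ha
  omega

lemma forms_inf_range {κ : Type} [Fintype κ] {e : κ → ℕ} {h : κ → S}
    (hh : ∀ j, h j ∈ forms (e j)) {D : ℕ} (he : ∀ j, e j ≤ D) :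
    forms D ⊓ (LinearMap.range (Fintype.linearCombination S h)).restrictScalars ℂ =
      (gradedPiece D e).map ((Fintype.linearCombination S h).restrictScalars ℂ) := by
  apply le_antisymm
  · rintro _ ⟨hv, u, rfl⟩
    refine ⟨fun j => shiftedComponent D (e j) (u j),
      mem_gradedPiece.mpr fun j => shiftedComponent_mem _ _ _, ?_⟩
    rw [← shiftedComponent_of_mem (Nat.zero_le D) hv]
    simp only [LinearMap.restrictScalars_apply, Fintype.linearCombination_apply, smul_eq_mul,
      map_sum]
    exact Finset.sum_congr rfl fun j _ =>
      (shiftedComponent_mul (degree_of_coeff_ne_zero (hh j)) _).symm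
  · rintro _ ⟨u, hu, rfl⟩
    refine ⟨?_, u, rfl⟩
    simp only [LinearMap.restrictScalars_apply, Fintype.linearCombination_apply, smul_eq_mul]
    exact Submodule.sum_mem _ fun j _ => mem_forms_of_coeff (he j)
      (degree_of_coeff_ne_zero (hh j)) (mem_gradedPiece.mp hu j)

/-- The Hilbert function of `S / I` for a homogeneous ideal `I`. -/
def hilbert (I : Ideal S) (k : ℕ) : ℕ :=
  Module.finrank ℂ ((forms k).map (Ideal.Quotient.mkₐ ℂ I).toLinearMap)

lemma ker_mkₐ_toLinearMap (I : Ideal S) :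
    LinearMap.ker (Ideal.Quotient.mkₐ ℂ I).toLinearMap = I.restrictScalars ℂ := by
  ext x
  simp [Ideal.Quotient.eq_zero_iff_mem]

lemma hilbert_add_finrank (I : Ideal S) (k : ℕ) :
    hilbert I k + Module.finrank ℂ (forms k ⊓ I.restrictScalars ℂ : Submodule ℂ S) =
      (k + 2).choose 2 := by
  rw [← finrank_forms, hilbert, ← ker_mkₐ_toLinearMap, finrank_map_add_finrank_inf_ker]

/-- The Jacobian ideal. -/
def jacobianIdeal (f : S) : Ideal S := Ideal.span (Set.range fun i => pderiv i f)

lemma range_jacobianMap (f : S) : LinearMap.range (jacobianMap f) = jacobianIdeal f :=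
  Fintype.range_linearCombination _ _

lemma pderiv_mem_forms {f : S} {d : ℕ} (hf : f.IsHomogeneous d) (i : Fin 3) :
    pderiv i f ∈ forms (d - 1) := hf.pderiv

/-- The Hilbert function of the Jacobian algebra, computed from a minimal resolution. -/
lemma MinimalResolution.hilbert_jacobianIdeal {f : S} {d : ℕ} (hf : f.IsHomogeneous d)
    (R : MinimalResolution f d) {D : ℕ} (hD : d - 1 ≤ D) (hD1 : ∀ i, d - 1 + R.deg i ≤ D)
    (hD2 : ∀ j, R.c j ≤ D) :
    hilbert (jacobianIdeal f) D + 3 * (D - (d - 1) + 2).choose 2 +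
        ∑ j, (D - R.c j + 2).choose 2 =
      (D + 2).choose 2 + ∑ i, (D - (d - 1 + R.deg i) + 2).choose 2 := by
  -- Rank-nullity is applied in degree `D` at each map; exactness identifies each kernel with the
  -- next image, and the last kernel is zero.
  have h0 := hilbert_add_finrank (jacobianIdeal f) D
  have h1 : Module.finrank ℂ
      ((gradedPiece D fun _ => d - 1).map ((jacobianMap f).restrictScalars ℂ)) +
      Module.finrank ℂ ((gradedPiece D fun _ => d - 1) ⊓
        LinearMap.ker ((jacobianMap f).restrictScalars ℂ) : Submodule ℂ (Fin 3 → S)) =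
      Module.finrank ℂ (gradedPiece (ι := Fin 3) D fun _ => d - 1) :=
    finrank_map_add_finrank_inf_ker _ _
  have h2 : Module.finrank ℂ
      ((gradedPiece D fun i => d - 1 + R.deg i).map (R.firstMap.restrictScalars ℂ)) +
      Module.finrank ℂ ((gradedPiece D fun i => d - 1 + R.deg i) ⊓
        LinearMap.ker (R.firstMap.restrictScalars ℂ) : Submodule ℂ (Fin R.m → S)) =
      Module.finrank ℂ (gradedPiece D fun i => d - 1 + R.deg i) :=
    finrank_map_add_finrank_inf_ker _ _
  have h3 : Module.finrank ℂ ((gradedPiece D R.c).map (R.secondMap.restrictScalars ℂ)) +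
      Module.finrank ℂ (gradedPiece D R.c ⊓
        LinearMap.ker (R.secondMap.restrictScalars ℂ) : Submodule ℂ (Fin R.n → S)) =
      Module.finrank ℂ (gradedPiece D R.c) :=
    finrank_map_add_finrank_inf_ker _ _
  have k1 : LinearMap.ker ((jacobianMap f).restrictScalars ℂ) =
      (LinearMap.range R.firstMap).restrictScalars ℂ := by
    rw [R.range_firstMap]
    rfl
  have k2 : LinearMap.ker (R.firstMap.restrictScalars ℂ) =
      (LinearMap.range R.secondMap).restrictScalars ℂ := by
    rw [R.range_secondMap]
    rfl
  have k3 : LinearMap.ker (R.secondMap.restrictScalars ℂ) = ⊥ := by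
    rw [LinearMap.ker_restrictScalars, R.ker_secondMap]
    rfl
  have e0 : forms D ⊓ (LinearMap.range (jacobianMap f)).restrictScalars ℂ =
      (gradedPiece D fun _ => d - 1).map ((jacobianMap f).restrictScalars ℂ) :=
    forms_inf_range (pderiv_mem_forms hf) fun _ => hD
  have e1 : (gradedPiece D fun _ => d - 1) ⊓ (LinearMap.range R.firstMap).restrictScalars ℂ =
      (gradedPiece D fun i => d - 1 + R.deg i).map (R.firstMap.restrictScalars ℂ) :=
    gradedPiece_inf_range
      (fun j i a ha => by rw [← R.isMinimal_first.homogeneous j i a ha]; omega) (fun _ => hD) hD1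
  have e2 : (gradedPiece D fun i => d - 1 + R.deg i) ⊓
      (LinearMap.range R.secondMap).restrictScalars ℂ =
      (gradedPiece D R.c).map (R.secondMap.restrictScalars ℂ) :=
    gradedPiece_inf_range R.isMinimal_second.homogeneous hD1 hD2
  have h0' : hilbert (jacobianIdeal f) D + Module.finrank ℂ
      ((gradedPiece D fun _ => d - 1).map ((jacobianMap f).restrictScalars ℂ)) =
      (D + 2).choose 2 := by
    rw [← range_jacobianMap, e0] at h0
    rw [← range_jacobianMap]
    exact h0
  rw [k1, e1] at h1
  rw [k2, e2] at h2
  rw [k3, inf_bot_eq, finrank_bot] at h3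
  rw [finrank_gradedPiece] at h1 h2 h3
  simp only [Finset.sum_const, Finset.card_univ, Fintype.card_fin, smul_eq_mul] at h1
  omega

/-! ### The partial derivatives of a squarefree form have no common factor -/

/-- A nonzero derivative has smaller total degree than `p`. -/
lemma pderiv_eq_zero_of_dvd {p : S} {i : Fin 3} (h : p ∣ pderiv i p) : pderiv i p = 0 := by
  by_contra h0
  have h1 := totalDegree_le_of_dvd_of_isDomain h h0
  obtain ⟨m, hm, hmd⟩ := Finset.exists_mem_eq_sup _ (support_nonempty.mpr h0)
    (fun s : Fin 3 →₀ ℕ => s.sum fun _ e => e)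
  change (pderiv i p).totalDegree = _ at hmd
  rw [mem_support_iff, coeff_pderiv] at hm
  have h2 := le_totalDegree (mem_support_iff.mpr (left_ne_zero_of_mul hm))
  rw [Finsupp.sum_add_index' (fun _ => rfl) (fun _ _ _ => rfl), Finsupp.sum_single_index rfl] at h2
  omega

lemma exists_eq_C_of_pderiv_eq_zero {p : S} (h : ∀ i, pderiv i p = 0) : ∃ c, p = C c := by
  refine ⟨coeff 0 p, ?_⟩
  ext m
  rw [coeff_C]
  split_ifs with hm
  · rw [hm]
  · obtain ⟨i, hi⟩ : ∃ i, m i ≠ 0 := by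
      by_contra! hall
      exact hm (Finsupp.ext hall).symm
    have h1 : coeff (m - Finsupp.single i 1) (pderiv i p) = 0 := by rw [h i, coeff_zero]
    have h2 : m - Finsupp.single i 1 + Finsupp.single i 1 = m :=
      tsub_add_cancel_of_le (Finsupp.single_le_iff.mpr (Nat.one_le_iff_ne_zero.mpr hi))
    rw [coeff_pderiv, h2] at h1
    refine (mul_eq_zero.mp h1).resolve_right ?_
    exact Nat.cast_add_one_ne_zero _

/-- Otherwise Euler's formula gives `f = p g`, with `p ∤ g` by squarefreeness. The product rule then
makes `p` divide its own derivatives, so `p` is constant. -/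
lemma exists_not_dvd_pderiv {f : S} {d : ℕ} (hd : 1 ≤ d) (hf : f.IsHomogeneous d)
    (hred : Squarefree f) {p : S} (hp : Prime p) : ∃ i, ¬ p ∣ pderiv i f := by
  by_contra! hdvd
  have hpf : p ∣ f := by
    have h1 : p ∣ (d : S) * f := by
      rw [← nsmul_eq_mul, ← hf.sum_X_mul_pderiv]
      exact Finset.dvd_sum fun i _ => Dvd.dvd.mul_left (hdvd i) _
    have hdC : (d : S) = C (d : ℂ) := by simp
    have hu : IsUnit (d : S) := by
      rw [hdC]
      exact (IsUnit.mk0 _ (Nat.cast_ne_zero.mpr (by omega))).map C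
    exact (hu.dvd_mul_left).mp h1
  obtain ⟨g, rfl⟩ := hpf
  have hpg : ¬ p ∣ g := fun ⟨k, hk⟩ =>
    hp.not_isUnit (hred p ⟨k, by rw [hk, mul_assoc]⟩)
  have hpp : ∀ i, pderiv i p = 0 := fun i => by
    refine pderiv_eq_zero_of_dvd ?_
    have h1 := hdvd i
    rw [pderiv_mul] at h1
    have h2 : p ∣ pderiv i p * g := (dvd_add_left (dvd_mul_right p _)).mp h1
    exact (hp.dvd_or_dvd h2).resolve_right hpg
  obtain ⟨c, rfl⟩ := exists_eq_C_of_pderiv_eq_zero hpp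
  have hc : c ≠ 0 := by
    rintro rfl
    exact hp.ne_zero (map_zero C)
  exact hp.not_isUnit ((IsUnit.mk0 _ hc).map C)

/-- The coefficient vectors of the linear combinations of the partial derivatives of `f` that are
divisible by `p`. -/
def divisibleCombinations (f p : S) : Submodule ℂ (Fin 3 → ℂ) :=
  ((Ideal.span {p}).restrictScalars ℂ).comap
    (Fintype.linearCombination ℂ fun i => pderiv i f)

lemma mem_divisibleCombinations {f p : S} {a : Fin 3 → ℂ} :
    a ∈ divisibleCombinations f p ↔ p ∣ ∑ i, a i • pderiv i f := by
  simp [divisibleCombinations, Fintype.linearCombination_apply, Ideal.mem_span_singleton]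

/-- `F` is a nonzero partial derivative and `G` a general combination of all three. For each prime
factor of `F`, the bad coefficient vectors form a proper subspace, and finitely many proper
subspaces do not cover `ℂ³`. -/
lemma exists_isRelPrime {f : S} {d : ℕ} (hd : 1 ≤ d) (hf : f.IsHomogeneous d)
    (hred : Squarefree f) : ∃ F G : S, F ∈ forms (d - 1) ∧ G ∈ forms (d - 1) ∧
      F ∈ jacobianIdeal f ∧ G ∈ jacobianIdeal f ∧ F ≠ 0 ∧ IsRelPrime F G := by
  classical
  -- Any prime would do: only a nonzero partial derivative is wanted.
  obtain ⟨i, hi⟩ := exists_not_dvd_pderiv hd hf hred (p := X 0) X_prime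
  have hF : pderiv i f ≠ 0 := fun h => hi (h ▸ dvd_zero _)
  have hmem : ∀ j, pderiv j f ∈ jacobianIdeal f := fun j => Ideal.subset_span ⟨j, rfl⟩
  obtain ⟨a, ha⟩ : ∃ a : Fin 3 → ℂ,
      ∀ p ∈ UniqueFactorizationMonoid.factors (pderiv i f), a ∉ divisibleCombinations f p := by
    have h := Subspace.biUnion_ne_univ_of_top_notMem (k := ℂ) (E := Fin 3 → ℂ)
      (s := (UniqueFactorizationMonoid.factors (pderiv i f)).toFinset.image
        (divisibleCombinations f)) ?_
    · obtain ⟨a, ha⟩ := (Set.ne_univ_iff_exists_notMem _).mp h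
      refine ⟨a, fun p hp hap => ha ?_⟩
      simp only [Set.mem_iUnion]
      exact ⟨_, Finset.mem_image_of_mem _ (Multiset.mem_toFinset.mpr hp), hap⟩
    · intro htop
      obtain ⟨p, hp, hptop⟩ := Finset.mem_image.mp htop
      obtain ⟨j, hj⟩ := exists_not_dvd_pderiv hd hf hred
        (UniqueFactorizationMonoid.prime_of_factor p (Multiset.mem_toFinset.mp hp))
      refine hj ?_
      have : Pi.single j 1 ∈ divisibleCombinations f p := hptop ▸ Submodule.mem_top
      rw [mem_divisibleCombinations] at this
      simpa [Pi.single_apply, ite_smul] using this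
  refine ⟨pderiv i f, ∑ j, a j • pderiv j f, pderiv_mem_forms hf i,
    Submodule.sum_mem _ fun j _ => Submodule.smul_mem _ _ (pderiv_mem_forms hf j), hmem i,
    Submodule.sum_mem _ fun j _ => ?_, hF, ?_⟩
  · rw [smul_eq_C_mul]
    exact Ideal.mul_mem_left _ _ (hmem j)
  · refine (UniqueFactorizationMonoid.isRelPrime_iff_no_prime_factors hF).mpr ?_
    intro p hpF hpG hp
    obtain ⟨q, hq, hpq⟩ := UniqueFactorizationMonoid.exists_mem_factors_of_dvd hF hp.irreducible hpF
    exact ha q hq (mem_divisibleCombinations.mpr (hpq.dvd_iff_dvd_left.mp hpG))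

/-! ### Complete intersections bound the Hilbert function -/

/-- Multiplication of a form by the syzygy `(G, -F)`. -/
def koszulSyzygy (F G : S) : S →ₗ[ℂ] (Fin 2 → S) :=
  LinearMap.pi ![LinearMap.mulRight ℂ G, LinearMap.mulRight ℂ (-F)]

/-- By coprimality the relations between `F` and `G` are multiples of `(G, -F)`. The Koszul count
shows that `(F, G)` has codimension at most `e²` in degree `k`, as in Bézout's theorem. -/
lemma hilbert_le_of_isRelPrime {I : Ideal S} {e : ℕ} {F G : S} (hF : F ∈ forms e)
    (hG : G ∈ forms e) (hFI : F ∈ I) (hGI : G ∈ I) (hF0 : F ≠ 0) (hFG : IsRelPrime F G) {k : ℕ}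
    (hk : 2 * e ≤ k) : hilbert I k ≤ e ^ 2 := by
  set φ : (Fin 2 → S) →ₗ[ℂ] S :=
    (Fintype.linearCombination S ![F, G]).restrictScalars ℂ with hφ
  have hφa : ∀ u, φ u = u 0 * F + u 1 * G := fun u => by
    simp [hφ, Fintype.linearCombination_apply, Fin.sum_univ_two]
  have h1 : Module.finrank ℂ ((gradedPiece k fun _ => e).map φ) +
      Module.finrank ℂ ((gradedPiece k fun _ => e) ⊓ LinearMap.ker φ :
        Submodule ℂ (Fin 2 → S)) = Module.finrank ℂ (gradedPiece (ι := Fin 2) k fun _ => e) :=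
    finrank_map_add_finrank_inf_ker _ _
  have h2 : (gradedPiece k fun _ => e).map φ ≤ forms k ⊓ I.restrictScalars ℂ := by
    rintro _ ⟨u, hu, rfl⟩
    have hmem := mem_gradedPiece.mp hu
    rw [hφa]
    refine ⟨Submodule.add_mem _ ?_ ?_, Submodule.add_mem _ ?_ ?_⟩
    · have := (mem_homogeneousSubmodule _ _).mp (hmem 0) |>.mul hF
      rwa [Nat.sub_add_cancel (by omega)] at this
    · have := (mem_homogeneousSubmodule _ _).mp (hmem 1) |>.mul hG
      rwa [Nat.sub_add_cancel (by omega)] at this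
    · exact Ideal.mul_mem_left _ _ hFI
    · exact Ideal.mul_mem_left _ _ hGI
  have h3 : ((gradedPiece k fun _ => e) ⊓ LinearMap.ker φ : Submodule ℂ (Fin 2 → S)) ≤
      (forms (k - 2 * e)).map (koszulSyzygy F G) := by
    rintro u ⟨hu, hker⟩
    have hmem := mem_gradedPiece.mp hu
    rw [SetLike.mem_coe, LinearMap.mem_ker, hφa] at hker
    obtain ⟨c, hc⟩ : F ∣ u 1 :=
      hFG.dvd_of_dvd_mul_right ⟨-u 0, by linear_combination hker⟩
    have hu0 : u 0 = -(c * G) := mul_left_cancel₀ hF0 (by rw [hc] at hker; linear_combination hker)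
    have hcF : c * F ∈ forms (k - e) := by rw [mul_comm, ← hc]; exact hmem 1
    have hcG : c * G ∈ forms (k - e) := by
      have := Submodule.neg_mem _ (hmem 0)
      rwa [hu0, neg_neg] at this
    -- The quotient `c` is not known to be a form; its component of degree `k - 2e` has the same
    -- products with `F` and `G`.
    refine ⟨-shiftedComponent k (2 * e) c, Submodule.neg_mem _ (shiftedComponent_mem _ _ _), ?_⟩
    have key : ∀ H ∈ forms e, c * H ∈ forms (k - e) →
        shiftedComponent k (2 * e) c * H = c * H := fun H hH hcH => by
      rw [← shiftedComponent_mul (w := e) (fun a ha => by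
        have := degree_of_coeff_ne_zero hH a ha
        omega), shiftedComponent_of_mem (by omega) hcH]
    ext1 i
    fin_cases i
    · simp [koszulSyzygy, key G hG hcG, hu0]
    · simp [koszulSyzygy, key F hF hcF, hc, mul_comm F c]
  have h4 := hilbert_add_finrank I k
  have h5 : Module.finrank ℂ ((gradedPiece k fun _ => e).map φ) ≤
      Module.finrank ℂ (forms k ⊓ I.restrictScalars ℂ : Submodule ℂ S) :=
    Submodule.finrank_mono h2
  have h6 : Module.finrank ℂ ((gradedPiece k fun _ => e) ⊓ LinearMap.ker φ :
      Submodule ℂ (Fin 2 → S)) ≤ (k - 2 * e + 2).choose 2 := by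
    rw [← finrank_forms]
    exact (Submodule.finrank_mono h3).trans (Submodule.finrank_map_le _ _)
  rw [finrank_gradedPiece] at h1
  simp only [Finset.sum_const, Finset.card_univ, Fintype.card_fin, smul_eq_mul] at h1
  have h7 : (k + 2).choose 2 + (k - 2 * e + 2).choose 2 = 2 * (k - e + 2).choose 2 + e ^ 2 := by
    obtain ⟨r, rfl⟩ := Nat.exists_eq_add_of_le hk
    rw [show 2 * e + r - e = e + r by omega, show 2 * e + r - 2 * e = r by omega]
    have hq : ∀ n : ℕ, ((n.choose 2 : ℕ) : ℚ) = n * (n - 1) / 2 := Nat.cast_choose_two ℚ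
    have : (((2 * e + r + 2).choose 2 + (r + 2).choose 2 : ℕ) : ℚ) =
        ((2 * (e + r + 2).choose 2 + e ^ 2 : ℕ) : ℚ) := by
      push_cast [hq]
      ring
    exact_mod_cast this
  omega

lemma hilbert_jacobianIdeal_le {f : S} {d : ℕ} (hd : 1 ≤ d) (hf : f.IsHomogeneous d)
    (hred : Squarefree f) {k : ℕ} (hk : 2 * (d - 1) ≤ k) :
    hilbert (jacobianIdeal f) k ≤ (d - 1) ^ 2 := by
  obtain ⟨F, G, hF, hG, hFI, hGI, hF0, hFG⟩ := exists_isRelPrime hd hf hred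
  exact hilbert_le_of_isRelPrime hF hG hFI hGI hF0 hFG hk

/-! ### Dehomogenization with respect to a linear form -/

/-- The ideal of the trace of the cone `I = 0` on the affine plane `ℓ = 1`. -/
def affineIdeal (I : Ideal S) (ℓ : S) : Ideal S := I ⊔ Ideal.span {ℓ - 1}

lemma le_affineIdeal (I : Ideal S) (ℓ : S) : I ≤ affineIdeal I ℓ := le_sup_left

/-- The functions on the trace of `I = 0` on the plane `ℓ = 1` that are given by forms of
degree `k`. -/
def traceForms (I : Ideal S) (ℓ : S) (k : ℕ) : Submodule ℂ (S ⧸ affineIdeal I ℓ) :=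
  (forms k).map (Ideal.Quotient.mkₐ ℂ (affineIdeal I ℓ)).toLinearMap

lemma traceForms_eq_map (I : Ideal S) (ℓ : S) (k : ℕ) :
    traceForms I ℓ k = ((forms k).map (Ideal.Quotient.mkₐ ℂ I).toLinearMap).map
      (Ideal.Quotient.factorₐ ℂ (le_affineIdeal I ℓ)).toLinearMap := by
  rw [traceForms, ← Submodule.map_comp]
  rfl

instance finite_traceForms (I : Ideal S) (ℓ : S) (k : ℕ) :
    Module.Finite ℂ (traceForms I ℓ k) :=
  inferInstanceAs (Module.Finite ℂ ((forms k).map _))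

lemma finrank_traceForms_le (I : Ideal S) (ℓ : S) (k : ℕ) :
    Module.finrank ℂ (traceForms I ℓ k) ≤ hilbert I k := by
  rw [traceForms_eq_map]
  exact Submodule.finrank_map_le _ _

lemma mk_mul_eq (I : Ideal S) (ℓ F : S) :
    Ideal.Quotient.mkₐ ℂ (affineIdeal I ℓ) (ℓ * F) = Ideal.Quotient.mkₐ ℂ (affineIdeal I ℓ) F := by
  refine Ideal.Quotient.eq.mpr (Ideal.mem_sup_right (Ideal.mem_span_singleton.mpr ⟨F, by ring⟩))

/-- Multiplication by `ℓ` raises the degree and is the identity on the plane `ℓ = 1`. -/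
lemma monotone_traceForms (I : Ideal S) {ℓ : S} (hℓ : ℓ ∈ forms 1) :
    Monotone (traceForms I ℓ) := by
  refine monotone_nat_of_le_succ fun k => ?_
  rintro _ ⟨F, hF, rfl⟩
  refine ⟨ℓ * F, ?_, mk_mul_eq I ℓ F⟩
  rw [add_comm k 1]
  exact hℓ.mul hF

lemma exists_mem_traceForms (I : Ideal S) {ℓ : S} (hℓ : ℓ ∈ forms 1) (x : S ⧸ affineIdeal I ℓ) :
    ∃ k, x ∈ traceForms I ℓ k := by
  obtain ⟨p, rfl⟩ := Ideal.Quotient.mk_surjective x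
  refine ⟨p.totalDegree, ?_⟩
  change Ideal.Quotient.mkₐ ℂ (affineIdeal I ℓ) p ∈ _
  have h : Ideal.Quotient.mkₐ ℂ (affineIdeal I ℓ) p = ∑ i ∈ Finset.range (p.totalDegree + 1),
      Ideal.Quotient.mkₐ ℂ (affineIdeal I ℓ) (homogeneousComponent i p) := by
    rw [← map_sum, sum_homogeneousComponent]
  rw [h]
  refine Submodule.sum_mem _ fun i hi => ?_
  exact monotone_traceForms I hℓ (Nat.lt_succ_iff.mp (Finset.mem_range.mp hi))
    ⟨_, homogeneousComponent_mem i p, rfl⟩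

lemma exists_forall_eq_of_antitone {g : ℕ → ℕ} {k₀ : ℕ} (hg : ∀ k ≥ k₀, g (k + 1) ≤ g k) :
    ∃ k₁ ≥ k₀, ∀ k ≥ k₁, g k = g k₁ := by
  have hanti : Antitone fun k => g (k₀ + k) :=
    antitone_nat_of_succ_le fun k => hg (k₀ + k) (Nat.le_add_right _ _)
  obtain ⟨n, hn⟩ := WellFoundedLT.antitone_chain_condition hanti
  refine ⟨k₀ + n, Nat.le_add_right _ _, fun k hk => ?_⟩
  obtain ⟨j, rfl⟩ := Nat.exists_eq_add_of_le hk
  have := hn (n + j) (Nat.le_add_right _ _)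
  rw [add_assoc]
  exact this.symm

/-- The trace spaces increase, exhaust the quotient and have bounded dimension, so they stabilize at
the whole quotient. -/
lemma exists_traceForms_eq_top (I : Ideal S) {ℓ : S} (hℓ : ℓ ∈ forms 1) {b k₀ : ℕ}
    (hb : ∀ k ≥ k₀, hilbert I k ≤ b) : ∃ k₁, ∀ k ≥ k₁, traceForms I ℓ k = ⊤ := by
  have hmono := monotone_traceForms I hℓ
  obtain ⟨k₁, hk₁, hconst⟩ := exists_forall_eq_of_antitone
    (g := fun k => b - Module.finrank ℂ (traceForms I ℓ k)) (k₀ := k₀)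
    fun k _ => Nat.sub_le_sub_left (Submodule.finrank_mono (hmono k.le_succ)) b
  have hle : ∀ k ≥ k₀, Module.finrank ℂ (traceForms I ℓ k) ≤ b := fun k hk =>
    (finrank_traceForms_le I ℓ k).trans (hb k hk)
  have heq : ∀ k ≥ k₁, traceForms I ℓ k₁ = traceForms I ℓ k := fun k hk => by
    refine Submodule.eq_of_le_of_finrank_le (hmono hk) ?_
    have h1 := hconst k hk
    have h2 := hle k (hk₁.le.trans hk)
    have h3 := hle k₁ hk₁
    omega
  have htop : traceForms I ℓ k₁ = ⊤ := by
    rw [eq_top_iff]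
    intro x _
    obtain ⟨k, hk⟩ := exists_mem_traceForms I hℓ x
    rw [heq (max k k₁) (le_max_right _ _)]
    exact hmono (le_max_left _ _) hk
  exact ⟨k₁, fun k hk => by rw [← heq k hk, htop]⟩

lemma finite_quotient_affineIdeal (I : Ideal S) {ℓ : S} (hℓ : ℓ ∈ forms 1) {b k₀ : ℕ}
    (hb : ∀ k ≥ k₀, hilbert I k ≤ b) : Module.Finite ℂ (S ⧸ affineIdeal I ℓ) := by
  obtain ⟨k₁, hk₁⟩ := exists_traceForms_eq_top I hℓ hb
  have h := finite_traceForms I ℓ k₁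
  rw [hk₁ k₁ le_rfl] at h
  exact Module.finite_def.mpr (Module.Finite.iff_fg.mp h)

/-- Homogenization in degree `N` by powers of a linear form. -/
def homogenize (ℓ : S) (N : ℕ) (p : S) : S :=
  ∑ i ∈ Finset.range (N + 1), ℓ ^ (N - i) * homogeneousComponent i p

lemma homogenize_mem {I : Ideal S} (hI : I.IsHomogeneous (homogeneousSubmodule (Fin 3) ℂ))
    (ℓ : S) (N : ℕ) {p : S} (hp : p ∈ I) : homogenize ℓ N p ∈ I :=
  Ideal.sum_mem _ fun i _ => Ideal.mul_mem_left _ _ (homogeneousComponent_mem_of_mem hI hp i)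

lemma homogenize_of_mem_forms (ℓ : S) {N k : ℕ} (hk : k ≤ N) {F : S} (hF : F ∈ forms k) :
    homogenize ℓ N F = ℓ ^ (N - k) * F := by
  rw [homogenize, Finset.sum_eq_single k]
  · rw [homogeneousComponent_of_mem hF, if_pos rfl]
  · intro i _ hi
    rw [homogeneousComponent_of_mem hF, if_neg hi, mul_zero]
  · intro h
    exact absurd (Finset.mem_range.mpr (by omega)) h

lemma homogeneousComponent_succ_mul {ℓ : S} (hℓ : ℓ ∈ forms 1) (i : ℕ) (H : S) :
    homogeneousComponent (i + 1) (ℓ * H) = ℓ * homogeneousComponent i H := by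
  rw [← coe_decompose, DirectSum.coe_decompose_mul_of_left_mem_of_le _ hℓ (by omega),
    coe_decompose, Nat.add_sub_cancel]

lemma homogeneousComponent_zero_mul {ℓ : S} (hℓ : ℓ ∈ forms 1) (H : S) :
    homogeneousComponent 0 (ℓ * H) = 0 := by
  rw [← coe_decompose, DirectSum.coe_decompose_mul_of_left_mem_of_not_le _ hℓ (by omega)]

lemma homogenize_mul {ℓ : S} (hℓ : ℓ ∈ forms 1) {N : ℕ} {H : S} (hH : H.totalDegree < N) :
    homogenize ℓ N (ℓ * H) = homogenize ℓ N H := by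
  rw [homogenize, Finset.sum_range_succ', homogenize, Finset.sum_range_succ,
    homogeneousComponent_zero_mul hℓ, homogeneousComponent_eq_zero _ _ hH, mul_zero, mul_zero]
  congr 1
  refine Finset.sum_congr rfl fun i hi => ?_
  have hi := Finset.mem_range.mp hi
  rw [homogeneousComponent_succ_mul hℓ, show N - i = N - (i + 1) + 1 by omega, pow_succ, mul_assoc]

lemma homogenize_add (ℓ : S) (N : ℕ) (p q : S) :
    homogenize ℓ N (p + q) = homogenize ℓ N p + homogenize ℓ N q := by
  simp only [homogenize, map_add, mul_add, Finset.sum_add_distrib]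

lemma homogenize_sub (ℓ : S) (N : ℕ) (p q : S) :
    homogenize ℓ N (p - q) = homogenize ℓ N p - homogenize ℓ N q := by
  simp only [homogenize, map_sub, mul_sub, Finset.sum_sub_distrib]

/-- Write `F = G + (ℓ - 1) H` with `G ∈ I`. Homogenizing by `ℓ` in a degree above that of `H` kills
the second term and keeps the first in `I`. -/
lemma exists_pow_mul_mem {I : Ideal S} (hI : I.IsHomogeneous (homogeneousSubmodule (Fin 3) ℂ))
    {ℓ : S} (hℓ : ℓ ∈ forms 1) {k : ℕ} {F : S} (hF : F ∈ forms k) (h : F ∈ affineIdeal I ℓ) :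
    ∃ e, ℓ ^ e * F ∈ I := by
  obtain ⟨G, hG, K, hK, rfl⟩ := Submodule.mem_sup.mp h
  obtain ⟨H, rfl⟩ := Ideal.mem_span_singleton.mp hK
  refine ⟨max k (H.totalDegree + 1) - k, ?_⟩
  rw [← homogenize_of_mem_forms ℓ (le_max_left _ _) hF, homogenize_add, sub_mul, one_mul,
    homogenize_sub, homogenize_mul hℓ (by omega), sub_self, add_zero]
  exact homogenize_mem hI _ _ hG

lemma forms_le_pow_idealOfVars {e k : ℕ} (h : e ≤ k) {F : S} (hF : F ∈ forms k) :
    F ∈ idealOfVars (Fin 3) ℂ ^ e := by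
  rw [mem_pow_idealOfVars_iff']
  intro x hx
  by_contra h0
  have := degree_of_coeff_ne_zero hF x h0
  omega

/-- If `I` and `ℓ` have no common zero in the projective plane, then every form of large degree is
congruent to a multiple of `ℓ` modulo `I`. -/
lemma map_forms_succ {I : Ideal S} (hI : I.IsHomogeneous (homogeneousSubmodule (Fin 3) ℂ))
    {ℓ : S} (hℓ : ℓ ∈ forms 1) {e : ℕ} (he : idealOfVars (Fin 3) ℂ ^ e ≤ I ⊔ Ideal.span {ℓ})
    {k : ℕ} (hk : e ≤ k) :
    (forms (k + 1)).map (Ideal.Quotient.mkₐ ℂ I).toLinearMap =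
      ((forms k).map (Ideal.Quotient.mkₐ ℂ I).toLinearMap).map
        (LinearMap.mulLeft ℂ (Ideal.Quotient.mkₐ ℂ I ℓ)) := by
  apply le_antisymm
  · rintro _ ⟨F, hF, rfl⟩
    obtain ⟨G, hG, K, hK, hFGK⟩ := Submodule.mem_sup.mp
      (he (forms_le_pow_idealOfVars (hk.trans k.le_succ) hF))
    obtain ⟨H, rfl⟩ := Ideal.mem_span_singleton.mp hK
    refine ⟨_, ⟨_, homogeneousComponent_mem k H, rfl⟩, ?_⟩
    have h1 : homogeneousComponent (k + 1) G + ℓ * homogeneousComponent k H = F := by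
      rw [← homogeneousComponent_succ_mul hℓ, ← map_add, hFGK, homogeneousComponent_of_mem hF,
        if_pos rfl]
    rw [← h1, LinearMap.mulLeft_apply, AlgHom.toLinearMap_apply, AlgHom.toLinearMap_apply, map_add,
      map_mul]
    have h2 : Ideal.Quotient.mkₐ ℂ I (homogeneousComponent (k + 1) G) = 0 :=
      Ideal.Quotient.eq_zero_iff_mem.mpr (homogeneousComponent_mem_of_mem hI hG _)
    rw [h2, zero_add]
  · rintro _ ⟨_, ⟨F, hF, rfl⟩, rfl⟩
    refine ⟨ℓ * F, ?_, by simp⟩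
    rw [add_comm k 1]
    exact hℓ.mul hF

/-- If `I` and `ℓ` have no common zero in the projective plane, then the Hilbert function of
`S / I` is eventually the length of the trace of `I = 0` on the plane `ℓ = 1`. -/
lemma exists_finrank_eq_hilbert {I : Ideal S}
    (hI : I.IsHomogeneous (homogeneousSubmodule (Fin 3) ℂ)) {ℓ : S} (hℓ : ℓ ∈ forms 1) {e : ℕ}
    (he : idealOfVars (Fin 3) ℂ ^ e ≤ I ⊔ Ideal.span {ℓ}) :
    ∃ k₀, ∀ k ≥ k₀, Module.finrank ℂ (S ⧸ affineIdeal I ℓ) = hilbert I k := by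
  -- Multiplication by `ℓ` is onto in degrees at least `e`, so the Hilbert function decreases until
  -- it is constant; from then on the multiplication is also injective.
  have hsucc : ∀ k ≥ e, hilbert I (k + 1) ≤ hilbert I k := fun k hk => by
    rw [hilbert, map_forms_succ hI hℓ he hk]
    exact Submodule.finrank_map_le _ _
  obtain ⟨k₁, hk₁, hconst⟩ := exists_forall_eq_of_antitone hsucc
  have hinj : ∀ k ≥ k₁, ∀ F ∈ forms k, ℓ * F ∈ I → F ∈ I := fun k hk F hF h => by
    have h1 : Module.finrank ℂ (((forms k).map (Ideal.Quotient.mkₐ ℂ I).toLinearMap).map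
        (LinearMap.mulLeft ℂ (Ideal.Quotient.mkₐ ℂ I ℓ))) +
        Module.finrank ℂ ((forms k).map (Ideal.Quotient.mkₐ ℂ I).toLinearMap ⊓
          LinearMap.ker (LinearMap.mulLeft ℂ (Ideal.Quotient.mkₐ ℂ I ℓ)) :
            Submodule ℂ (S ⧸ I)) = hilbert I k := finrank_map_add_finrank_inf_ker _ _
    rw [← map_forms_succ hI hℓ he (hk₁.le.trans hk)] at h1
    change hilbert I (k + 1) + _ = _ at h1
    rw [hconst k hk, hconst (k + 1) (by omega), Nat.add_eq_left,
      Submodule.finrank_eq_zero] at h1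
    have h2 : Ideal.Quotient.mkₐ ℂ I F ∈ ((forms k).map (Ideal.Quotient.mkₐ ℂ I).toLinearMap ⊓
        LinearMap.ker (LinearMap.mulLeft ℂ (Ideal.Quotient.mkₐ ℂ I ℓ)) :
            Submodule ℂ (S ⧸ I)) := by
      refine ⟨⟨F, hF, rfl⟩, ?_⟩
      rw [SetLike.mem_coe, LinearMap.mem_ker, LinearMap.mulLeft_apply, ← map_mul]
      exact Ideal.Quotient.eq_zero_iff_mem.mpr h
    rw [h1, Submodule.mem_bot] at h2
    exact Ideal.Quotient.eq_zero_iff_mem.mp h2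
  have hinj' : ∀ r, ∀ k ≥ k₁, ∀ F ∈ forms k, ℓ ^ r * F ∈ I → F ∈ I := by
    intro r
    induction r with
    | zero => simp
    | succ r ih =>
      intro k hk F hF h
      refine hinj k hk F hF (ih (1 + k) (by omega) _ (hℓ.mul hF) ?_)
      rwa [← mul_assoc, ← pow_succ]
  obtain ⟨k₂, hk₂⟩ := exists_traceForms_eq_top I hℓ (b := hilbert I k₁) (k₀ := k₁)
    fun k hk => (hconst k hk).le
  refine ⟨max k₁ k₂, fun k hk => ?_⟩
  rw [← finrank_top, ← hk₂ k ((le_max_right _ _).trans hk), traceForms_eq_map]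
  have h1 : Module.finrank ℂ (((forms k).map (Ideal.Quotient.mkₐ ℂ I).toLinearMap).map
      (Ideal.Quotient.factorₐ ℂ (le_affineIdeal I ℓ)).toLinearMap) +
      Module.finrank ℂ ((forms k).map (Ideal.Quotient.mkₐ ℂ I).toLinearMap ⊓
        LinearMap.ker (Ideal.Quotient.factorₐ ℂ (le_affineIdeal I ℓ)).toLinearMap :
          Submodule ℂ (S ⧸ I)) = hilbert I k := finrank_map_add_finrank_inf_ker _ _
  -- A form vanishing on the trace is killed by a power of `ℓ` modulo `I`, hence lies in `I`. So
  -- restriction to the plane loses nothing in degree `k`.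
  have h2 : ((forms k).map (Ideal.Quotient.mkₐ ℂ I).toLinearMap ⊓
        LinearMap.ker (Ideal.Quotient.factorₐ ℂ (le_affineIdeal I ℓ)).toLinearMap :
          Submodule ℂ (S ⧸ I)) = ⊥ := by
    rw [Submodule.eq_bot_iff]
    rintro _ ⟨⟨F, hF, rfl⟩, hker⟩
    have hF' : F ∈ affineIdeal I ℓ := Ideal.Quotient.eq_zero_iff_mem.mp hker
    obtain ⟨r, hr⟩ := exists_pow_mul_mem hI hℓ hF hF'
    exact Ideal.Quotient.eq_zero_iff_mem.mpr
      (hinj' r k ((le_max_left _ _).trans hk) F hF hr)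
  rw [h2, finrank_bot, add_zero] at h1
  exact h1

/-! ### Finite-dimensional quotients and localization -/

/-- Since `m ^ N ≤ A`, every element outside `m` is already invertible modulo `A`, so localizing
does not change the quotient. -/
lemma finrank_localization_quotient {K B : Type*} [Field K] [CommRing B] [Algebra K B]
    (m : Ideal B) [m.IsPrime] (hm : m.IsMaximal) {A : Ideal B} {N : ℕ} (h : m ^ N ≤ A) :
    Module.finrank K (Localization.AtPrime m ⧸ A.map (algebraMap B (Localization.AtPrime m))) =
      Module.finrank K (B ⧸ A) := by
  have hinv : ∀ s ∉ m, ∃ s', s * s' - 1 ∈ A := fun s hs => by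
    obtain ⟨y, hy⟩ := (Ideal.Quotient.isUnit_mk_pow_of_notMem (n := N) m hs).exists_right_inv
    obtain ⟨s', rfl⟩ := Ideal.Quotient.mk_surjective y
    rw [← map_mul, ← map_one (Ideal.Quotient.mk (m ^ N)), Ideal.Quotient.eq] at hy
    exact ⟨s', h hy⟩
  set φ : (B ⧸ A) →ₐ[K] (Localization.AtPrime m ⧸ A.map (algebraMap B (Localization.AtPrime m))) :=
    Ideal.quotientMapₐ _ (IsScalarTower.toAlgHom K B (Localization.AtPrime m))
      Ideal.le_comap_map with hφ
  have hinj : Function.Injective φ := by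
    refine Ideal.quotientMap_injective' (H := Ideal.le_comap_map) ?_
    intro x hx
    obtain ⟨s, hs, hsx⟩ := (IsLocalization.algebraMap_mem_map_algebraMap_iff m.primeCompl
      (Localization.AtPrime m) A x).mp hx
    obtain ⟨s', hs'⟩ := hinv s hs
    have : x = s' * (s * x) - (s * s' - 1) * x := by ring
    rw [this]
    exact A.sub_mem (A.mul_mem_left _ hsx) (A.mul_mem_right _ hs')
  have hsurj : Function.Surjective φ := by
    intro y
    obtain ⟨y, rfl⟩ := Ideal.Quotient.mk_surjective y
    obtain ⟨b, s, rfl⟩ := IsLocalization.exists_mk'_eq m.primeCompl y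
    obtain ⟨s', hs'⟩ := hinv s s.2
    refine ⟨Ideal.Quotient.mk A (b * s'), ?_⟩
    change Ideal.Quotient.mk _ (algebraMap B (Localization.AtPrime m) (b * s')) = _
    rw [Ideal.Quotient.eq]
    have : algebraMap B (Localization.AtPrime m) (b * s') - IsLocalization.mk' _ b s =
        IsLocalization.mk' (Localization.AtPrime m) b s * algebraMap B _ (s * s' - 1) := by
      rw [map_sub, map_one, map_mul, map_mul, mul_sub, mul_one, ← mul_assoc,
        IsLocalization.mk'_spec]
    rw [this]
    exact Ideal.mul_mem_left _ _ (Ideal.mem_map_of_mem _ hs')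
  exact (LinearEquiv.ofBijective φ.toLinearMap ⟨hinj, hsurj⟩).finrank_eq.symm

/-- The quotient `B ⧸ I` is Artinian, so the powers of the image of `m` stabilize. -/
lemma eventually_pow_le_sup {K B : Type*} [Field K] [CommRing B] [Algebra K B] (m I : Ideal B)
    [Module.Finite K (B ⧸ I)] : ∀ᶠ N in atTop, m ^ N ≤ I ⊔ m ^ (N + 1) := by
  have : IsArtinianRing (B ⧸ I) := IsArtinianRing.of_finite K _
  obtain ⟨n, hn⟩ := IsArtinian.monotone_stabilizes
    (⟨fun N => OrderDual.toDual ((m.map (Ideal.Quotient.mk I)) ^ N),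
      fun _ _ h => Ideal.pow_le_pow_right h⟩ : ℕ →o (Ideal (B ⧸ I))ᵒᵈ)
  filter_upwards [eventually_ge_atTop n] with N hN
  have h1 : (m.map (Ideal.Quotient.mk I)) ^ N = (m.map (Ideal.Quotient.mk I)) ^ (N + 1) :=
    (hn N hN).symm.trans (hn (N + 1) (by omega))
  rw [← Ideal.map_pow, ← Ideal.map_pow] at h1
  have h2 : m ^ N ≤ (m ^ (N + 1)).comap (RingHom.id B) ⊔ I := by
    have h3 := Ideal.map_le_iff_le_comap.mp h1.le
    rwa [Ideal.comap_map_of_surjective _ Ideal.Quotient.mk_surjective, ← RingHom.ker_eq_comap_bot,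
      Ideal.mk_ker] at h3
  rw [sup_comm]
  exact h2

/-- The length of a zero-dimensional scheme at a point, as the length of the intersection with
large infinitesimal neighbourhoods of the point. -/
lemma eventually_finrank_localization_quotient {K B : Type*} [Field K] [CommRing B] [Algebra K B]
    [IsNoetherianRing B] (m : Ideal B) [m.IsPrime] (hm : m.IsMaximal) (I : Ideal B)
    [Module.Finite K (B ⧸ I)] :
    ∀ᶠ N in atTop, Module.finrank K
      (Localization.AtPrime m ⧸ I.map (algebraMap B (Localization.AtPrime m))) =
      Module.finrank K (B ⧸ (I ⊔ m ^ N)) := by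
  filter_upwards [eventually_pow_le_sup (K := K) m I] with N hN
  rw [← finrank_localization_quotient m hm (le_sup_right : m ^ N ≤ I ⊔ m ^ N)]
  have h1 : (I ⊔ m ^ N).map (algebraMap B (Localization.AtPrime m)) =
      I.map (algebraMap B (Localization.AtPrime m)) := by
    apply le_antisymm
    · rw [Ideal.map_sup]
      refine sup_le le_rfl ?_
      -- Nakayama's lemma in the local ring, from `m ^ N ≤ I ⊔ m * m ^ N`.
      refine Submodule.le_of_le_smul_of_le_jacobson_bot
        (I := m.map (algebraMap B (Localization.AtPrime m))) (IsNoetherian.noetherian _) ?_ ?_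
      · rw [IsLocalRing.jacobson_eq_maximalIdeal _ bot_ne_top]
        exact (IsLocalization.AtPrime.map_eq_maximalIdeal m _).le
      · rw [smul_eq_mul, ← Ideal.map_mul, ← Ideal.map_sup, ← pow_succ']
        exact Ideal.map_mono hN
    · exact Ideal.map_mono le_sup_left
  rw [h1]

/-- The quotient by the preimage of an ideal under a surjective homomorphism. -/
def quotientComapEquiv {K A B : Type*} [Field K] [CommRing A] [CommRing B] [Algebra K A]
    [Algebra K B] (φ : A →ₐ[K] B) (hφ : Function.Surjective φ) (I : Ideal B) :
    (A ⧸ I.comap φ) ≃ₗ[K] B ⧸ I :=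
  LinearEquiv.ofBijective (Ideal.quotientMapₐ (I := I.comap φ) I φ le_rfl).toLinearMap
    ⟨Ideal.quotientMap_injective' (f := (φ : A →+* B)) (H := le_rfl) le_rfl,
      Ideal.quotientMap_surjective (f := (φ : A →+* B)) (H := le_rfl) hφ⟩

/-! ### The Chinese remainder theorem for zero-dimensional schemes -/

lemma finrank_quotient_iInf {K B ι : Type*} [Field K] [CommRing B] [Algebra K B] [Fintype ι]
    {A : ι → Ideal B} (hA : Pairwise (Function.onFun IsCoprime A))
    (hfin : ∀ i, Module.Finite K (B ⧸ A i)) :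
    Module.finrank K (B ⧸ ⨅ i, A i) = ∑ i, Module.finrank K (B ⧸ A i) := by
  set φ : (B ⧸ ⨅ i, A i) →ₐ[K] ∀ i, B ⧸ A i := Ideal.Quotient.liftₐ (⨅ i, A i)
    (AlgHom.pi fun i => Ideal.Quotient.mkₐ K (A i)) fun x hx =>
      funext fun i => Ideal.Quotient.eq_zero_iff_mem.mpr ((Ideal.mem_iInf.mp hx) i) with hφ
  have hinj : Function.Injective φ := by
    rw [injective_iff_map_eq_zero]
    intro x hx
    obtain ⟨x, rfl⟩ := Ideal.Quotient.mk_surjective x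
    exact Ideal.Quotient.eq_zero_iff_mem.mpr
      (Ideal.mem_iInf.mpr fun i => Ideal.Quotient.eq_zero_iff_mem.mp (congrFun hx i))
  have hsurj : Function.Surjective φ := fun y => by
    obtain ⟨x, hx⟩ := Ideal.pi_quotient_surjective hA y
    exact ⟨Ideal.Quotient.mk _ x, funext hx⟩
  rw [(LinearEquiv.ofBijective φ.toLinearMap ⟨hinj, hsurj⟩).finrank_eq,
    Module.finrank_pi_fintype]

lemma sup_mul_sup_le {B : Type*} [CommRing B] (I A A' : Ideal B) :
    (I ⊔ A) * (I ⊔ A') ≤ I ⊔ A * A' := by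
  refine Ideal.mul_le.mpr fun x hx y hy => ?_
  obtain ⟨a, ha, b, hb, rfl⟩ := Submodule.mem_sup.mp hx
  obtain ⟨a', ha', b', hb', rfl⟩ := Submodule.mem_sup.mp hy
  rw [show (a + b) * (a' + b') = (a * (a' + b') + b * a') + b * b' by ring]
  exact Ideal.add_mem _ (Ideal.mem_sup_left
    (I.add_mem (I.mul_mem_right _ ha) (I.mul_mem_left _ ha')))
    (Ideal.mem_sup_right (Ideal.mul_mem_mul hb hb'))

lemma prod_sup_le {B ι : Type*} [CommRing B] (I : Ideal B) (A : ι → Ideal B) (s : Finset ι) :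
    ∏ i ∈ s, (I ⊔ A i) ≤ I ⊔ ∏ i ∈ s, A i := by
  classical
  induction s using Finset.induction_on with
  | empty => simp
  | insert i s hi ih =>
    rw [Finset.prod_insert hi, Finset.prod_insert hi]
    exact (Ideal.mul_mono le_rfl ih).trans (sup_mul_sup_le _ _ _)

/-- The maximal ideal of a point of affine space. -/
abbrev pointMaximalIdeal {σ : Type*} (v : σ → ℂ) : Ideal (MvPolynomial σ ℂ) :=
  RingHom.ker (eval v : MvPolynomial σ ℂ →+* ℂ)

lemma isMaximal_pointMaximalIdeal {σ : Type*} (v : σ → ℂ) : (pointMaximalIdeal v).IsMaximal :=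
  RingHom.ker_isMaximal_of_surjective _ fun c => ⟨C c, eval_C c⟩

lemma pointMaximalIdeal_injective {σ : Type*} :
    Function.Injective (pointMaximalIdeal : (σ → ℂ) → Ideal (MvPolynomial σ ℂ)) := by
  intro v w h
  ext i
  have h1 : X i - C (v i) ∈ pointMaximalIdeal w := by
    rw [← h, RingHom.mem_ker]
    simp
  rw [RingHom.mem_ker] at h1
  simp only [map_sub, eval_X, eval_C] at h1
  exact (sub_eq_zero.mp h1).symm

lemma le_radical_of_forall_eval {σ : Type} [Finite σ] {I K : Ideal (MvPolynomial σ ℂ)}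
    (h : ∀ v : σ → ℂ, (∀ F ∈ K, eval v F = 0) → ∀ F ∈ I, eval v F = 0) : I ≤ K.radical := by
  rw [← vanishingIdeal_zeroLocus_eq_radical (K := ℂ)]
  intro F hF v hv
  exact h v (fun G hG => hv G hG) F hF

/-- The length of a zero-dimensional scheme is the sum of its lengths at its points. -/
lemma eventually_sum_finrank {σ ι : Type} [Finite σ] [Fintype ι] {I : Ideal (MvPolynomial σ ℂ)}
    [Module.Finite ℂ (MvPolynomial σ ℂ ⧸ I)] {v : ι → σ → ℂ} (hv : Function.Injective v)
    (h : ∀ w, (∀ F ∈ I, eval w F = 0) → w ∈ Set.range v) :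
    ∀ᶠ N in atTop, ∑ i, Module.finrank ℂ (MvPolynomial σ ℂ ⧸ (I ⊔ pointMaximalIdeal (v i) ^ N)) =
      Module.finrank ℂ (MvPolynomial σ ℂ ⧸ I) := by
  have hrad : ∏ i, pointMaximalIdeal (v i) ≤ I.radical :=
    le_radical_of_forall_eval fun w hw F hF => by
      obtain ⟨i, rfl⟩ := h w hw
      have := Ideal.prod_le_inf.trans (Finset.inf_le (Finset.mem_univ i)) hF
      exact this
  obtain ⟨n, hn⟩ := Ideal.exists_pow_le_of_le_radical_of_fg hrad (IsNoetherian.noetherian _)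
  filter_upwards [eventually_ge_atTop n] with N hN
  have hcop : Pairwise (Function.onFun IsCoprime
      fun i => I ⊔ pointMaximalIdeal (v i) ^ N) := fun i j hij => by
    have h1 : IsCoprime (pointMaximalIdeal (v i)) (pointMaximalIdeal (v j)) :=
      Ideal.isCoprime_iff_sup_eq.mpr ((isMaximal_pointMaximalIdeal (v i)).coprime_of_ne
        (isMaximal_pointMaximalIdeal (v j)) fun h => hij (hv (pointMaximalIdeal_injective h)))
    have h2 := Ideal.isCoprime_iff_sup_eq.mp (h1.pow (m := N) (n := N))
    refine Ideal.isCoprime_iff_sup_eq.mpr (top_le_iff.mp ?_)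
    rw [← h2]
    exact sup_le_sup le_sup_right le_sup_right
  have hfin : ∀ i, Module.Finite ℂ (MvPolynomial σ ℂ ⧸ (I ⊔ pointMaximalIdeal (v i) ^ N)) :=
    fun i => Module.Finite.of_surjective
      (Ideal.Quotient.factorₐ ℂ (le_sup_left : I ≤ I ⊔ pointMaximalIdeal (v i) ^ N)).toLinearMap
      (Ideal.Quotient.factor_surjective le_sup_left)
  rw [← finrank_quotient_iInf hcop hfin]
  -- By the Nullstellensatz a power of the product of the maximal ideals lies in `I`; for comaximal
  -- ideals, intersection and product agree.
  have heq : ⨅ i, (I ⊔ pointMaximalIdeal (v i) ^ N) = I := by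
    apply le_antisymm
    · have h1 := Ideal.prod_eq_iInf_of_pairwise_isCoprime (s := Finset.univ)
        (J := fun i => I ⊔ pointMaximalIdeal (v i) ^ N) fun i _ j _ hij => hcop hij
      simp only [Finset.mem_univ, iInf_pos] at h1
      rw [← h1]
      refine (prod_sup_le _ _ _).trans (sup_le le_rfl ?_)
      rw [Finset.prod_pow]
      exact (Ideal.pow_le_pow_right hN).trans hn
    · exact le_iInf fun i => le_sup_left
  rw [heq]

/-- A zero-dimensional scheme has finitely many points. -/
lemma finite_zeros {σ : Type} [Finite σ] (I : Ideal (MvPolynomial σ ℂ))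
    [Module.Finite ℂ (MvPolynomial σ ℂ ⧸ I)] :
    {v : σ → ℂ | ∀ F ∈ I, eval v F = 0}.Finite := by
  set x : σ → MvPolynomial σ ℂ ⧸ I := fun i => Ideal.Quotient.mkₐ ℂ I (X i) with hx
  refine (Set.Finite.pi' fun i => (minpoly ℂ (x i)).rootSet_finite ℂ).subset ?_
  intro v hv i
  -- Each coordinate of a zero is a root of the minimal polynomial of the class of that coordinate
  -- function.
  have hint : IsIntegral ℂ (x i) := IsIntegral.of_finite ℂ _
  rw [Polynomial.mem_rootSet]
  refine ⟨minpoly.ne_zero hint, ?_⟩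
  have h1 : Polynomial.aeval (X i : MvPolynomial σ ℂ) (minpoly ℂ (x i)) ∈ I := by
    rw [← Ideal.Quotient.eq_zero_iff_mem]
    change Ideal.Quotient.mkₐ ℂ I _ = 0
    rw [← Polynomial.aeval_algHom_apply]
    exact minpoly.aeval ℂ (x i)
  have h2 := hv _ h1
  rw [← coe_aeval_eq_eval] at h2
  change aeval v (Polynomial.aeval (X i : MvPolynomial σ ℂ) (minpoly ℂ (x i))) = 0 at h2
  rwa [← Polynomial.aeval_algHom_apply, aeval_X] at h2

/-! ### Points of the projective plane and linear forms -/

lemma eval_smul_of_mem_forms {k : ℕ} {F : S} (hF : F ∈ forms k) (c : ℂ) (v : Fin 3 → ℂ) :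
    eval (c • v) F = c ^ k * eval v F := by
  rw [eval_eq, eval_eq, Finset.mul_sum]
  refine Finset.sum_congr rfl fun a ha => ?_
  have hk : ∑ i ∈ a.support, a i = k := by
    have := degree_of_coeff_ne_zero hF a (mem_support_iff.mp ha)
    rw [add_zero] at this
    exact this
  simp only [Pi.smul_apply, smul_eq_mul, mul_pow, Finset.prod_mul_distrib]
  rw [Finset.prod_pow_eq_pow_sum, hk]
  ring

/-- The homogeneous ideal of the point `[v]` of the projective plane. -/
def projPointIdeal (v : Fin 3 → ℂ) : Ideal S :=
  Ideal.span (Set.range fun ij : Fin 3 × Fin 3 => C (v ij.2) * X ij.1 - C (v ij.1) * X ij.2)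

lemma isHomogeneous_projPointIdeal (v : Fin 3 → ℂ) :
    (projPointIdeal v).IsHomogeneous (homogeneousSubmodule (Fin 3) ℂ) := by
  refine Ideal.homogeneous_span _ _ ?_
  rintro _ ⟨⟨i, j⟩, rfl⟩
  exact ⟨1, (isHomogeneous_C_mul_X _ _).sub (isHomogeneous_C_mul_X _ _)⟩

/-- The expression is linear in `ℓ`, and for `ℓ` a coordinate it is a generator. -/
lemma C_eval_mul_X_sub_mem (v : Fin 3 → ℂ) {ℓ : S} (hℓ : ℓ ∈ forms 1) (j : Fin 3) :
    C (eval v ℓ) * X j - C (v j) * ℓ ∈ projPointIdeal v := by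
  rw [forms, homogeneousSubmodule_one_eq_span_X] at hℓ
  induction hℓ using Submodule.span_induction with
  | mem x hx =>
    obtain ⟨i, rfl⟩ := hx
    rw [eval_X]
    exact Ideal.subset_span ⟨(j, i), rfl⟩
  | zero => simp
  | add x y _ _ hx hy =>
    have h := Ideal.add_mem _ hx hy
    rw [map_add, C_add]
    convert h using 1
    ring
  | smul c x _ hx =>
    have h := Ideal.mul_mem_left _ (C c) hx
    rw [smul_eq_C_mul, map_mul, eval_C, C_mul]
    convert h using 1
    ring

lemma idealOfVars_le_projPointIdeal_sup {v : Fin 3 → ℂ} {ℓ : S} (hℓ : ℓ ∈ forms 1)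
    (hv : eval v ℓ ≠ 0) : idealOfVars (Fin 3) ℂ ≤ projPointIdeal v ⊔ Ideal.span {ℓ} := by
  refine Ideal.span_le.mpr ?_
  rintro _ ⟨j, rfl⟩
  have h : (X j : S) = C (eval v ℓ)⁻¹ * (C (eval v ℓ) * X j - C (v j) * ℓ) +
      C (eval v ℓ)⁻¹ * C (v j) * ℓ := by
    have h1 : (C (eval v ℓ)⁻¹ * C (eval v ℓ) : S) = 1 := by
      rw [← C_mul, inv_mul_cancel₀ hv, C_1]
    linear_combination -(X j : S) * h1
  rw [h]
  exact Ideal.add_mem _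
    (Ideal.mem_sup_left (Ideal.mul_mem_left _ _ (C_eval_mul_X_sub_mem v hℓ j)))
    (Ideal.mem_sup_right (Ideal.mul_mem_left _ _ (Ideal.mem_span_singleton_self ℓ)))

lemma pow_sup_le {B : Type*} [CommRing B] (I A : Ideal B) (N : ℕ) : (I ⊔ A) ^ N ≤ I ⊔ A ^ N := by
  have h := prod_sup_le I (fun _ : ℕ => A) (Finset.range N)
  simpa using h

/-- The representative of the point `[v]` on the plane `ℓ = 1`. -/
def normalizedRep (v : Fin 3 → ℂ) (ℓ : S) : Fin 3 → ℂ := (eval v ℓ)⁻¹ • v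

lemma eval_normalizedRep {v : Fin 3 → ℂ} {ℓ : S} (hℓ : ℓ ∈ forms 1) (hv : eval v ℓ ≠ 0) :
    eval (normalizedRep v ℓ) ℓ = 1 := by
  rw [normalizedRep, eval_smul_of_mem_forms hℓ, pow_one, inv_mul_cancel₀ hv]

lemma projPointIdeal_le (v : Fin 3 → ℂ) (c : ℂ) :
    projPointIdeal v ≤ pointMaximalIdeal (c • v) := by
  refine Ideal.span_le.mpr ?_
  rintro _ ⟨⟨i, j⟩, rfl⟩
  rw [SetLike.mem_coe, RingHom.mem_ker]
  simp only [map_sub, map_mul, eval_C, eval_X, Pi.smul_apply, smul_eq_mul]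
  ring

lemma pointMaximalIdeal_le_affineIdeal {v : Fin 3 → ℂ} {ℓ : S} (hℓ : ℓ ∈ forms 1)
    (hv : eval v ℓ ≠ 0) :
    pointMaximalIdeal (normalizedRep v ℓ) ≤ affineIdeal (projPointIdeal v) ℓ := by
  have hX : ∀ j, X j - C (normalizedRep v ℓ j) ∈ affineIdeal (projPointIdeal v) ℓ := fun j => by
    have h : X j - C (normalizedRep v ℓ j) =
        C (eval v ℓ)⁻¹ * (C (eval v ℓ) * X j - C (v j) * ℓ) +
        C (eval v ℓ)⁻¹ * C (v j) * (ℓ - 1) := by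
      have h1 : (C (eval v ℓ)⁻¹ * C (eval v ℓ) : S) = 1 := by
        rw [← C_mul, inv_mul_cancel₀ hv, C_1]
      rw [normalizedRep, Pi.smul_apply, smul_eq_mul, C_mul]
      linear_combination -(X j : S) * h1
    rw [h]
    exact Ideal.add_mem _
      (Ideal.mem_sup_left (Ideal.mul_mem_left _ _ (C_eval_mul_X_sub_mem v hℓ j)))
      (Ideal.mem_sup_right (Ideal.mul_mem_left _ _ (Ideal.mem_span_singleton_self _)))
  intro p hp
  have h : Ideal.Quotient.mkₐ ℂ (affineIdeal (projPointIdeal v) ℓ) =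
      (Algebra.ofId ℂ _).comp (aeval (normalizedRep v ℓ)) := by
    ext j
    have h1 := Ideal.Quotient.eq.mpr (hX j)
    rw [AlgHom.comp_apply, aeval_X]
    exact h1
  have h2 := DFunLike.congr_fun h p
  rw [AlgHom.comp_apply] at h2
  have h3 : aeval (normalizedRep v ℓ) p = 0 := hp
  rw [h3, map_zero] at h2
  exact Ideal.Quotient.eq_zero_iff_mem.mp h2

/-- This presents an infinitesimal neighbourhood in the plane as the trace of a homogeneous ideal
independent of `ℓ`, which allows comparison of charts. -/
lemma affineIdeal_sup_projPointIdeal_pow (I : Ideal S) {v : Fin 3 → ℂ} {ℓ : S} (hℓ : ℓ ∈ forms 1)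
    (hv : eval v ℓ ≠ 0) (N : ℕ) : affineIdeal (I ⊔ projPointIdeal v ^ N) ℓ =
      affineIdeal I ℓ ⊔ pointMaximalIdeal (normalizedRep v ℓ) ^ N := by
  apply le_antisymm
  · refine sup_le (sup_le ?_ ?_) ?_
    · exact le_sup_left.trans le_sup_left
    · exact (Ideal.pow_right_mono (projPointIdeal_le v _) N).trans le_sup_right
    · exact le_sup_right.trans le_sup_left
  · refine sup_le (sup_le ?_ le_sup_right) ?_
    · exact le_sup_left.trans le_sup_left
    · refine (Ideal.pow_right_mono (pointMaximalIdeal_le_affineIdeal hℓ hv) N).trans ?_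
      rw [affineIdeal, sup_comm]
      refine (pow_sup_le _ _ N).trans ?_
      exact sup_le le_sup_right (le_sup_right.trans le_sup_left)

lemma isHomogeneous_pow {I : Ideal S} (hI : I.IsHomogeneous (homogeneousSubmodule (Fin 3) ℂ))
    (N : ℕ) : (I ^ N).IsHomogeneous (homogeneousSubmodule (Fin 3) ℂ) := by
  induction N with
  | zero =>
    rw [pow_zero, Ideal.one_eq_top]
    exact Ideal.IsHomogeneous.top _
  | succ N ih =>
    rw [pow_succ]
    exact ih.mul hI

/-- The length at a projective point of a scheme defined by a homogeneous ideal does not depend on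
the affine chart. -/
lemma finrank_affine_eq {I : Ideal S} (hI : I.IsHomogeneous (homogeneousSubmodule (Fin 3) ℂ))
    {v : Fin 3 → ℂ} {ℓ ℓ' : S} (hℓ : ℓ ∈ forms 1) (hℓ' : ℓ' ∈ forms 1) (hv : eval v ℓ ≠ 0)
    (hv' : eval v ℓ' ≠ 0) (N : ℕ) :
    Module.finrank ℂ (S ⧸ (affineIdeal I ℓ ⊔ pointMaximalIdeal (normalizedRep v ℓ) ^ N)) =
      Module.finrank ℂ (S ⧸ (affineIdeal I ℓ' ⊔ pointMaximalIdeal (normalizedRep v ℓ') ^ N)) := by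
  have hhom : (I ⊔ projPointIdeal v ^ N).IsHomogeneous (homogeneousSubmodule (Fin 3) ℂ) :=
    hI.sup (isHomogeneous_pow (isHomogeneous_projPointIdeal v) N)
  have hle : ∀ {μ : S}, μ ∈ forms 1 → eval v μ ≠ 0 →
      idealOfVars (Fin 3) ℂ ^ N ≤ (I ⊔ projPointIdeal v ^ N) ⊔ Ideal.span {μ} := fun hμ hvμ => by
    refine (Ideal.pow_right_mono (idealOfVars_le_projPointIdeal_sup hμ hvμ) N).trans ?_
    rw [sup_comm]
    refine (pow_sup_le _ _ N).trans ?_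
    exact sup_le le_sup_right (le_sup_right.trans le_sup_left)
  rw [← affineIdeal_sup_projPointIdeal_pow I hℓ hv, ← affineIdeal_sup_projPointIdeal_pow I hℓ' hv']
  -- Both lengths are the eventual value of one Hilbert function, that of `I ⊔ projPointIdeal v ^
  -- N`.
  obtain ⟨k, hk⟩ := exists_finrank_eq_hilbert hhom hℓ (hle hℓ hv)
  obtain ⟨k', hk'⟩ := exists_finrank_eq_hilbert hhom hℓ' (hle hℓ' hv')
  rw [hk (max k k') (le_max_left _ _), hk' (max k k') (le_max_right _ _)]

/-! ### Affine charts -/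

lemma dehomogenize_X_self (i : Fin 3) : dehomogenize i (X i) = 1 := by
  simp [dehomogenize]

lemma dehomogenize_X_succAbove (i : Fin 3) (j : Fin 2) :
    dehomogenize i (X (i.succAbove j)) = X j := by
  simp [dehomogenize]

lemma eval_dehomogenize (i : Fin 3) (a : Fin 2 → ℂ) (F : S) :
    eval a (dehomogenize i F) = eval (i.insertNth (α := fun _ => ℂ) 1 a) F := by
  have h : (aeval a).comp (dehomogenize i) =
      (aeval (i.insertNth (α := fun _ => ℂ) 1 a) : S →ₐ[ℂ] ℂ) := by
    ext k
    rcases Fin.eq_self_or_eq_succAbove i k with rfl | ⟨j, rfl⟩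
    · rw [AlgHom.comp_apply, dehomogenize_X_self, aeval_X, Fin.insertNth_apply_same, map_one]
    · rw [AlgHom.comp_apply, dehomogenize_X_succAbove, aeval_X, aeval_X,
        Fin.insertNth_apply_succAbove]
  exact DFunLike.congr_fun h F

lemma dehomogenize_rename (i : Fin 3) (q : MvPolynomial (Fin 2) ℂ) :
    dehomogenize i (rename i.succAbove q) = q := by
  have h : (dehomogenize i).comp (rename i.succAbove) = AlgHom.id ℂ _ := by
    ext j : 1
    rw [AlgHom.comp_apply, rename_X, dehomogenize_X_succAbove, AlgHom.id_apply]
  exact DFunLike.congr_fun h q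

lemma dehomogenize_surjective (i : Fin 3) : Function.Surjective (dehomogenize i) :=
  fun q => ⟨_, dehomogenize_rename i q⟩

lemma sub_rename_dehomogenize_mem (i : Fin 3) (F : S) :
    F - rename i.succAbove (dehomogenize i F) ∈ Ideal.span {(X i : S) - 1} := by
  have h : (Ideal.Quotient.mkₐ ℂ (Ideal.span {(X i : S) - 1})).comp
      ((rename i.succAbove).comp (dehomogenize i)) = Ideal.Quotient.mkₐ ℂ _ := by
    ext k
    rcases Fin.eq_self_or_eq_succAbove i k with rfl | ⟨j, rfl⟩
    · rw [AlgHom.comp_apply, AlgHom.comp_apply, dehomogenize_X_self, map_one]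
      exact (Ideal.Quotient.eq.mpr (Ideal.mem_span_singleton_self _)).symm
    · rw [AlgHom.comp_apply, AlgHom.comp_apply, dehomogenize_X_succAbove, rename_X]
  exact Ideal.Quotient.eq.mp (DFunLike.congr_fun h F).symm

lemma comap_map_dehomogenize (i : Fin 3) (I : Ideal S) :
    (I.map (dehomogenize i)).comap (dehomogenize i) = affineIdeal I (X i) := by
  rw [Ideal.comap_map_of_surjective _ (dehomogenize_surjective i), affineIdeal]
  congr 1
  apply le_antisymm
  · intro F hF
    have h := sub_rename_dehomogenize_mem i F
    have h0 : dehomogenize i F = 0 := hF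
    rwa [h0, map_zero, sub_zero] at h
  · rw [Ideal.span_singleton_le_iff_mem, Ideal.mem_comap, map_sub, dehomogenize_X_self, map_one,
      sub_self]
    exact Ideal.zero_mem _

lemma comap_dehomogenize_sup_pow (i : Fin 3) (I : Ideal S) (a : Fin 2 → ℂ) (N : ℕ) :
    (I.map (dehomogenize i) ⊔ pointMaximalIdeal a ^ N).comap (dehomogenize i) =
      affineIdeal I (X i) ⊔
        pointMaximalIdeal (i.insertNth (α := fun _ => ℂ) 1 a : Fin 3 → ℂ) ^ N := by
  have h1 : (pointMaximalIdeal (i.insertNth (α := fun _ => ℂ) 1 a : Fin 3 → ℂ)).map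
      (dehomogenize i) = pointMaximalIdeal a := by
    have h2 : pointMaximalIdeal (i.insertNth (α := fun _ => ℂ) 1 a : Fin 3 → ℂ) =
        (pointMaximalIdeal a).comap (dehomogenize i) := by
      ext F
      rw [Ideal.mem_comap, RingHom.mem_ker, RingHom.mem_ker, ← eval_dehomogenize]
    rw [h2, Ideal.map_comap_of_surjective _ (dehomogenize_surjective i)]
  rw [← h1, ← Ideal.map_pow, ← Ideal.map_sup, comap_map_dehomogenize, affineIdeal, affineIdeal,
    sup_right_comm]

lemma pderiv_dehomogenize (i : Fin 3) (j : Fin 2) (F : S) :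
    pderiv j (dehomogenize i F) = dehomogenize i (pderiv (i.succAbove j) F) := by
  induction F using MvPolynomial.induction_on with
  | C c =>
    rw [pderiv_C, map_zero, dehomogenize, algHom_C]
    exact pderiv_C
  | add p q hp hq => simp only [map_add, hp, hq]
  | mul_X p k hp =>
    rw [map_mul, pderiv_mul, pderiv_mul, map_add, map_mul, map_mul, hp]
    congr 2
    rcases Fin.eq_self_or_eq_succAbove i k with rfl | ⟨l, rfl⟩
    · rw [dehomogenize_X_self, pderiv_one, pderiv_X_of_ne (Fin.ne_succAbove _ _), map_zero]
    · rw [dehomogenize_X_succAbove]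
      by_cases hl : l = j
      · rw [hl, pderiv_X_self, pderiv_X_self, map_one]
      · rw [pderiv_X_of_ne hl, pderiv_X_of_ne fun h => hl (Fin.succAbove_right_injective h),
          map_zero]

/-- In an affine chart, the Jacobian ideal is the Tjurina ideal of a local equation. -/
lemma map_dehomogenize_jacobianIdeal {f : S} {d : ℕ} (hd : 1 ≤ d) (hf : f.IsHomogeneous d)
    (i : Fin 3) : (jacobianIdeal f).map (dehomogenize i) =
      Ideal.span {dehomogenize i f, pderiv 0 (dehomogenize i f), pderiv 1 (dehomogenize i f)} := by
  -- Euler's formula on `X i = 1` trades the partial derivative in direction `i` for the local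
  -- equation itself, as `d` is invertible.
  have heuler : dehomogenize i (pderiv i f) + ∑ j, X j * pderiv j (dehomogenize i f) =
      C (d : ℂ) * dehomogenize i f := by
    have h := congrArg (dehomogenize i) hf.sum_X_mul_pderiv
    rw [Fin.sum_univ_succAbove _ i] at h
    simp only [map_add, map_sum, map_mul, dehomogenize_X_self, dehomogenize_X_succAbove, one_mul,
      ← pderiv_dehomogenize] at h
    rw [h, map_nsmul, nsmul_eq_mul]
    simp
  rw [Fin.sum_univ_two] at heuler
  have hdC : (C (d : ℂ)⁻¹ * C (d : ℂ) : MvPolynomial (Fin 2) ℂ) = 1 := by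
    rw [← C_mul, inv_mul_cancel₀ (Nat.cast_ne_zero.mpr (by omega)), C_1]
  have hmem : ∀ k, dehomogenize i (pderiv k f) ∈ (jacobianIdeal f).map (dehomogenize i) :=
    fun k => Ideal.mem_map_of_mem _ (Ideal.subset_span ⟨k, rfl⟩)
  have hmem' : ∀ j, pderiv j (dehomogenize i f) ∈ (jacobianIdeal f).map (dehomogenize i) :=
    fun j => by
      rw [pderiv_dehomogenize]
      exact hmem _
  apply le_antisymm
  · rw [jacobianIdeal, Ideal.map_span]
    refine Ideal.span_le.mpr ?_
    have h0 : dehomogenize i f ∈ Ideal.span {dehomogenize i f, pderiv 0 (dehomogenize i f),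
        pderiv 1 (dehomogenize i f)} := Ideal.subset_span (by simp)
    have hj : ∀ j : Fin 2, pderiv j (dehomogenize i f) ∈ Ideal.span {dehomogenize i f,
        pderiv 0 (dehomogenize i f), pderiv 1 (dehomogenize i f)} := fun j => by
      fin_cases j <;> exact Ideal.subset_span (by simp)
    rintro _ ⟨_, ⟨k, rfl⟩, rfl⟩
    change dehomogenize i (pderiv k f) ∈ _
    rcases Fin.eq_self_or_eq_succAbove i k with rfl | ⟨j, rfl⟩
    · rw [eq_sub_of_add_eq heuler]
      exact Ideal.sub_mem _ (Ideal.mul_mem_left _ _ h0)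
        (Ideal.add_mem _ (Ideal.mul_mem_left _ _ (hj 0)) (Ideal.mul_mem_left _ _ (hj 1)))
    · rw [← pderiv_dehomogenize]
      exact hj j
  · refine Ideal.span_le.mpr ?_
    rintro _ (rfl | rfl | rfl)
    · have h : dehomogenize i f = C (d : ℂ)⁻¹ * (dehomogenize i (pderiv i f) +
          (X 0 * pderiv 0 (dehomogenize i f) + X 1 * pderiv 1 (dehomogenize i f))) := by
        rw [heuler, ← mul_assoc, hdC, one_mul]
      rw [h]
      exact Ideal.mul_mem_left _ _ (Ideal.add_mem _ (hmem i)
        (Ideal.add_mem _ (Ideal.mul_mem_left _ _ (hmem' 0)) (Ideal.mul_mem_left _ _ (hmem' 1))))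
    · exact hmem' 0
    · exact hmem' 1

/-! ### The total Tjurina number is the degree of the Jacobian scheme -/

lemma isHomogeneous_jacobianIdeal {f : S} {d : ℕ} (hf : f.IsHomogeneous d) :
    (jacobianIdeal f).IsHomogeneous (homogeneousSubmodule (Fin 3) ℂ) := by
  refine Ideal.homogeneous_span _ _ ?_
  rintro _ ⟨i, rfl⟩
  exact ⟨d - 1, pderiv_mem_forms hf i⟩

lemma X_mem_forms (i : Fin 3) : (X i : S) ∈ forms 1 := isHomogeneous_X ℂ i

lemma rep_chart_ne_zero (p : Projectivization ℂ (Fin 3 → ℂ)) : p.rep (chart p) ≠ 0 :=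
  Classical.choose_spec (Function.ne_iff.mp p.rep_nonzero)

lemma insertNth_affineCoords (p : Projectivization ℂ (Fin 3 → ℂ)) :
    ((chart p).insertNth (α := fun _ => ℂ) 1 (affineCoords p) : Fin 3 → ℂ) =
      normalizedRep p.rep (X (chart p)) := by
  ext k
  rw [normalizedRep, eval_X, Pi.smul_apply, smul_eq_mul]
  rcases Fin.eq_self_or_eq_succAbove (chart p) k with h | ⟨j, h⟩
  · rw [h, Fin.insertNth_apply_same, inv_mul_cancel₀ (rep_chart_ne_zero p)]
  · rw [h, Fin.insertNth_apply_succAbove, affineCoords, div_eq_inv_mul]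

lemma finite_quotient_affineIdeal_jacobianIdeal {f : S} {d : ℕ} (hd : 1 ≤ d)
    (hf : f.IsHomogeneous d) (hred : Squarefree f) {ℓ : S} (hℓ : ℓ ∈ forms 1) :
    Module.Finite ℂ (S ⧸ affineIdeal (jacobianIdeal f) ℓ) :=
  finite_quotient_affineIdeal _ hℓ fun _ hk => hilbert_jacobianIdeal_le hd hf hred hk

/-- The local numbers are defined in charts depending on `p`; this moves them to a plane `ℓ = 1`
that can serve all singular points at once. -/
lemma eventually_localTjurina_eq {f : S} {d : ℕ} (hd : 1 ≤ d) (hf : f.IsHomogeneous d)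
    (hred : Squarefree f) (p : Projectivization ℂ (Fin 3 → ℂ)) {ℓ : S} (hℓ : ℓ ∈ forms 1)
    (hp : eval p.rep ℓ ≠ 0) :
    ∀ᶠ N in atTop, localTjurina (dehomogenize (chart p) f) (affineCoords p) =
      Module.finrank ℂ (S ⧸ (affineIdeal (jacobianIdeal f) ℓ ⊔
        pointMaximalIdeal (normalizedRep p.rep ℓ) ^ N)) := by
  have hfin := finite_quotient_affineIdeal_jacobianIdeal hd hf hred (X_mem_forms (chart p))
  rw [← comap_map_dehomogenize] at hfin
  have hfin' : Module.Finite ℂ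
      (MvPolynomial (Fin 2) ℂ ⧸ (jacobianIdeal f).map (dehomogenize (chart p))) :=
    Module.Finite.equiv (quotientComapEquiv (dehomogenize (chart p)) (dehomogenize_surjective _) _)
  filter_upwards [eventually_finrank_localization_quotient (K := ℂ)
    (pointMaximalIdeal (affineCoords p)) (isMaximal_pointMaximalIdeal _)
    ((jacobianIdeal f).map (dehomogenize (chart p)))] with N hN
  rw [localTjurina, ← map_dehomogenize_jacobianIdeal hd hf, hN,
    ← (quotientComapEquiv (dehomogenize (chart p)) (dehomogenize_surjective _) _).finrank_eq,
    comap_dehomogenize_sup_pow, insertNth_affineCoords]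
  exact finrank_affine_eq (isHomogeneous_jacobianIdeal hf) (X_mem_forms _) hℓ
    (by rw [eval_X]; exact rep_chart_ne_zero p) hp N

/-- The singular points of the curve `f = 0`. -/
def singularPoints (f : S) : Set (Projectivization ℂ (Fin 3 → ℂ)) :=
  {p | ∀ F ∈ jacobianIdeal f, eval p.rep F = 0}

lemma eval_smul_eq_zero_of_forall {f : S} {d : ℕ} (hf : f.IsHomogeneous d) {v : Fin 3 → ℂ}
    (hv : ∀ F ∈ jacobianIdeal f, eval v F = 0) (c : ℂ) :
    ∀ F ∈ jacobianIdeal f, eval (c • v) F = 0 := by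
  have h : jacobianIdeal f ≤ pointMaximalIdeal (c • v) := by
    refine Ideal.span_le.mpr ?_
    rintro _ ⟨i, rfl⟩
    rw [SetLike.mem_coe, RingHom.mem_ker, eval_smul_of_mem_forms (pderiv_mem_forms hf i),
      hv _ (Ideal.subset_span ⟨i, rfl⟩), mul_zero]
  exact h

lemma smul_normalizedRep {v : Fin 3 → ℂ} {ℓ : S} (hv : eval v ℓ ≠ 0) :
    eval v ℓ • normalizedRep v ℓ = v := by
  rw [normalizedRep, smul_smul, mul_inv_cancel₀ hv, one_smul]

lemma eq_of_normalizedRep_eq {p q : Projectivization ℂ (Fin 3 → ℂ)} {ℓ : S}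
    (hp : eval p.rep ℓ ≠ 0) (h : normalizedRep p.rep ℓ = normalizedRep q.rep ℓ) :
    p = q := by
  rw [← p.mk_rep, ← q.mk_rep, Projectivization.mk_eq_mk_iff']
  refine ⟨eval p.rep ℓ * (eval q.rep ℓ)⁻¹, ?_⟩
  rw [mul_smul]
  change eval p.rep ℓ • normalizedRep q.rep ℓ = p.rep
  rw [← h, smul_normalizedRep hp]

/-- Away from the singular points the Jacobian ideal is comaximal with the ideal of the point, hence
with its powers. -/
lemma localTjurina_eq_zero {f : S} {d : ℕ} (hd : 1 ≤ d) (hf : f.IsHomogeneous d)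
    (hred : Squarefree f) {p : Projectivization ℂ (Fin 3 → ℂ)} (hp : p ∉ singularPoints f) :
    localTjurina (dehomogenize (chart p) f) (affineCoords p) = 0 := by
  have hne : eval p.rep (X (chart p)) ≠ 0 := by rw [eval_X]; exact rep_chart_ne_zero p
  obtain ⟨N, hN⟩ := (eventually_localTjurina_eq hd hf hred p (X_mem_forms _) hne).exists
  rw [hN]
  have hmax := isMaximal_pointMaximalIdeal (normalizedRep p.rep (X (chart p)))
  have htop : affineIdeal (jacobianIdeal f) (X (chart p)) ⊔
      pointMaximalIdeal (normalizedRep p.rep (X (chart p))) ^ N = ⊤ := by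
    have h1 : affineIdeal (jacobianIdeal f) (X (chart p)) ⊔
        pointMaximalIdeal (normalizedRep p.rep (X (chart p))) = ⊤ := by
      refine hmax.out.lt_iff.mp (lt_of_le_of_ne le_sup_right fun h => hp ?_)
      have hle : jacobianIdeal f ≤ pointMaximalIdeal (normalizedRep p.rep (X (chart p))) := by
        rw [h]
        exact (le_affineIdeal _ _).trans le_sup_left
      have hz := eval_smul_eq_zero_of_forall hf hle (eval p.rep (X (chart p)))
      rwa [smul_normalizedRep hne] at hz
    have h2 := pow_sup_le (affineIdeal (jacobianIdeal f) (X (chart p)))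
      (pointMaximalIdeal (normalizedRep p.rep (X (chart p)))) N
    rw [h1, Ideal.top_pow] at h2
    exact top_le_iff.mp h2
  rw [htop]
  have : Subsingleton (S ⧸ (⊤ : Ideal S)) := Ideal.Quotient.subsingleton_iff.mpr rfl
  exact Module.finrank_zero_of_subsingleton

lemma finite_singularPoints {f : S} {d : ℕ} (hd : 1 ≤ d) (hf : f.IsHomogeneous d)
    (hred : Squarefree f) : (singularPoints f).Finite := by
  have hsub : singularPoints f ⊆ ⋃ i : Fin 3, {p ∈ singularPoints f | p.rep i ≠ 0} := fun p hp =>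
    Set.mem_iUnion.mpr ⟨chart p, hp, rep_chart_ne_zero p⟩
  refine (Set.finite_iUnion fun i => ?_).subset hsub
  have := finite_quotient_affineIdeal_jacobianIdeal hd hf hred (X_mem_forms i)
  refine Set.Finite.of_injOn (f := fun p => normalizedRep p.rep (X i)) ?_ ?_
    (finite_zeros (affineIdeal (jacobianIdeal f) (X i)))
  · rintro p ⟨hp, hpi⟩
    have hne : eval p.rep (X i) ≠ 0 := by rwa [eval_X]
    have hle : affineIdeal (jacobianIdeal f) (X i) ≤
        pointMaximalIdeal (normalizedRep p.rep (X i)) := by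
      refine sup_le (eval_smul_eq_zero_of_forall hf hp _) ?_
      rw [Ideal.span_singleton_le_iff_mem, RingHom.mem_ker, map_sub, map_one,
        eval_normalizedRep (X_mem_forms i) hne, sub_self]
    exact hle
  · rintro p ⟨_, hpi⟩ q _ h
    exact eq_of_normalizedRep_eq (by rwa [eval_X]) h

/-- Linear forms vanishing at a given point form a proper subspace, and finitely many of these do
not cover `ℂ³`. -/
lemma exists_linear_form_ne_zero {Z : Set (Projectivization ℂ (Fin 3 → ℂ))} (hZ : Z.Finite) :
    ∃ ℓ : S, ℓ ∈ forms 1 ∧ ∀ p ∈ Z, eval p.rep ℓ ≠ 0 := by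
  classical
  let H : Projectivization ℂ (Fin 3 → ℂ) → Submodule ℂ (Fin 3 → ℂ) := fun p =>
    LinearMap.ker (Fintype.linearCombination ℂ p.rep)
  have h := Subspace.biUnion_ne_univ_of_top_notMem (k := ℂ) (E := Fin 3 → ℂ)
    (s := hZ.toFinset.image H) ?_
  · obtain ⟨a, ha⟩ := (Set.ne_univ_iff_exists_notMem _).mp h
    refine ⟨∑ j, C (a j) * X j, Submodule.sum_mem _ fun j _ => isHomogeneous_C_mul_X _ _,
      fun p hp h0 => ha ?_⟩
    simp only [Set.mem_iUnion]
    refine ⟨H p, Finset.mem_image_of_mem _ (hZ.mem_toFinset.mpr hp), ?_⟩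
    rw [SetLike.mem_coe, LinearMap.mem_ker, Fintype.linearCombination_apply]
    simpa using h0
  · intro htop
    obtain ⟨p, -, hp⟩ := Finset.mem_image.mp htop
    have h1 : Pi.single (chart p) 1 ∈ H p := hp ▸ Submodule.mem_top
    rw [LinearMap.mem_ker, Fintype.linearCombination_apply_single, one_smul] at h1
    exact rep_chart_ne_zero p h1

/-- The Hilbert polynomial of the Jacobian algebra is the total Tjurina number. -/
lemma exists_hilbert_eq_totalTjurina {f : S} {d : ℕ} (hd : 1 ≤ d) (hf : f.IsHomogeneous d)
    (hred : Squarefree f) : ∃ k₀, ∀ k ≥ k₀, hilbert (jacobianIdeal f) k = totalTjurina f := by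
  have hZ := finite_singularPoints hd hf hred
  obtain ⟨ℓ, hℓ, hℓZ⟩ := exists_linear_form_ne_zero hZ
  have hmk : ∀ w : Fin 3 → ℂ, (∀ F ∈ jacobianIdeal f, eval w F = 0) → w ≠ 0 →
      ∃ p ∈ singularPoints f, ∃ a : ℂ, p.rep = a • w := fun w hw hw0 => by
    obtain ⟨a, ha⟩ := Projectivization.exists_smul_eq_mk_rep ℂ w hw0
    refine ⟨Projectivization.mk ℂ w hw0, ?_, a, ha.symm⟩
    change ∀ F ∈ jacobianIdeal f, eval (Projectivization.mk ℂ w hw0).rep F = 0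
    rw [← ha]
    exact eval_smul_eq_zero_of_forall hf hw a
  -- Since `ℓ` avoids the singular points, `J_f` and `ℓ` vanish together at most at the origin.
  have hrad : idealOfVars (Fin 3) ℂ ≤ (jacobianIdeal f ⊔ Ideal.span {ℓ}).radical :=
    le_radical_of_forall_eval fun w hw => by
      have hw0 : w = 0 := by
        by_contra hw0
        obtain ⟨p, hp, a, ha⟩ := hmk w (fun F hF => hw F (Ideal.mem_sup_left hF)) hw0
        refine hℓZ p hp ?_
        rw [ha, eval_smul_of_mem_forms hℓ,
          hw ℓ (Ideal.mem_sup_right (Ideal.mem_span_singleton_self ℓ)), mul_zero]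
      have hle : idealOfVars (Fin 3) ℂ ≤ pointMaximalIdeal w := by
        refine Ideal.span_le.mpr ?_
        rintro _ ⟨i, rfl⟩
        rw [SetLike.mem_coe, RingHom.mem_ker, eval_X, hw0, Pi.zero_apply]
      exact hle
  obtain ⟨e, he⟩ := Ideal.exists_pow_le_of_le_radical_of_fg hrad (IsNoetherian.noetherian _)
  obtain ⟨k₀, hk₀⟩ := exists_finrank_eq_hilbert (isHomogeneous_jacobianIdeal hf) hℓ he
  refine ⟨k₀, fun k hk => ?_⟩
  rw [← hk₀ k hk]
  have := finite_quotient_affineIdeal_jacobianIdeal hd hf hred hℓ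
  let v : hZ.toFinset → Fin 3 → ℂ := fun p => normalizedRep p.1.rep ℓ
  have hvℓ : ∀ p : hZ.toFinset, eval p.1.rep ℓ ≠ 0 := fun p =>
    hℓZ p.1 (hZ.mem_toFinset.mp p.2)
  have hv : Function.Injective v := fun p q h =>
    Subtype.ext (eq_of_normalizedRep_eq (hvℓ p) h)
  have hrange : ∀ w, (∀ F ∈ affineIdeal (jacobianIdeal f) ℓ, eval w F = 0) →
      w ∈ Set.range v := fun w hw => by
    have hwℓ : eval w ℓ = 1 := by
      have h := hw (ℓ - 1) (Ideal.mem_sup_right (Ideal.mem_span_singleton_self _))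
      rwa [map_sub, map_one, sub_eq_zero] at h
    have hw0 : w ≠ 0 := by
      rintro rfl
      have h := eval_smul_of_mem_forms hℓ 0 (0 : Fin 3 → ℂ)
      rw [smul_zero, hwℓ] at h
      simp at h
    obtain ⟨p, hp, a, ha⟩ := hmk w (fun F hF => hw F (Ideal.mem_sup_left hF)) hw0
    refine ⟨⟨p, hZ.mem_toFinset.mpr hp⟩, ?_⟩
    have hpa : eval p.rep ℓ = a := by
      rw [ha, eval_smul_of_mem_forms hℓ, hwℓ, pow_one, mul_one]
    have ha0 : a ≠ 0 := hpa ▸ hℓZ p hp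
    change (eval p.rep ℓ)⁻¹ • p.rep = w
    rw [hpa, ha, smul_smul, inv_mul_cancel₀ ha0, one_smul]
  have hloc : ∀ᶠ N in atTop, ∀ p : hZ.toFinset,
      localTjurina (dehomogenize (chart p.1) f) (affineCoords p.1) =
        Module.finrank ℂ (S ⧸ (affineIdeal (jacobianIdeal f) ℓ ⊔ pointMaximalIdeal (v p) ^ N)) :=
    eventually_all.mpr fun p => eventually_localTjurina_eq hd hf hred p.1 hℓ (hvℓ p)
  obtain ⟨N, hN1, hN2⟩ := ((eventually_sum_finrank hv hrange).and hloc).exists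
  rw [← hN1, totalTjurina, finsum_eq_sum_of_support_subset (s := hZ.toFinset)]
  · rw [← Finset.sum_coe_sort hZ.toFinset fun p =>
      localTjurina (dehomogenize (chart p) f) (affineCoords p)]
    exact (Finset.sum_congr rfl fun p _ => hN2 p).symm
  · intro p hp
    rw [Set.Finite.coe_toFinset]
    by_contra h
    exact hp (localTjurina_eq_zero hd hf hred h)

/-! ### Numerical consequences of the resolution -/

lemma coeffs_eq_zero_of_eventually {A B C : ℚ} {K : ℕ}
    (h : ∀ D : ℕ, K ≤ D → A * (D : ℚ) ^ 2 + B * D + C = 0) : A = 0 ∧ B = 0 ∧ C = 0 := by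
  have h0 := h K le_rfl
  have h1 := h (K + 1) (by omega)
  have h2 := h (K + 2) (by omega)
  push_cast at h1 h2
  have hA : A = 0 := by linear_combination (h2 - 2 * h1 + h0) / 2
  subst hA
  have hB : B = 0 := by linear_combination h1 - h0
  subst hB
  exact ⟨rfl, rfl, by linear_combination h0⟩

lemma cast_choose_sub {D a : ℕ} (h : a ≤ D) :
    (((D - a + 2).choose 2 : ℕ) : ℚ) =
      1 / 2 * (D : ℚ) ^ 2 + (3 - 2 * a) / 2 * D + ((a : ℚ) ^ 2 - 3 * a + 2) / 2 := by
  rw [Nat.cast_choose_two]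
  push_cast [Nat.cast_sub h]
  ring

lemma sum_cast_choose_sub {k : ℕ} {w : Fin k → ℕ} {D : ℕ} (h : ∀ i, w i ≤ D) :
    ∑ i, (((D - w i + 2).choose 2 : ℕ) : ℚ) =
      k / 2 * (D : ℚ) ^ 2 + (3 * k - 2 * ∑ i, (w i : ℚ)) / 2 * D +
        (∑ i, (w i : ℚ) ^ 2 - 3 * ∑ i, (w i : ℚ) + 2 * k) / 2 := by
  rw [Finset.sum_congr rfl fun i _ => cast_choose_sub (h i)]
  simp only [Finset.sum_add_distrib, ← Finset.sum_mul, ← Finset.sum_div, Finset.sum_sub_distrib,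
    ← Finset.mul_sum, Finset.sum_const, Finset.card_univ, Fintype.card_fin, nsmul_eq_mul]
  ring

namespace MinimalResolution

variable {f : S} {d : ℕ} (R : MinimalResolution f d)

lemma exponent_succ (i : Fin R.m) : R.exponent (i + 1) = R.deg i := by
  rw [exponent, dif_pos ⟨by omega, by omega⟩]
  rfl

lemma secondDegree_succ (j : Fin R.n) : R.secondDegree (j + 1) = R.c j := by
  rw [secondDegree, dif_pos ⟨by omega, by omega⟩]
  rfl

lemma exponent_mono {k l : ℕ} (hk : 1 ≤ k) (hkl : k ≤ l) (hl : l ≤ R.m) :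
    R.exponent k ≤ R.exponent l := by
  rw [exponent, exponent, dif_pos ⟨hk, hkl.trans hl⟩, dif_pos ⟨hk.trans hkl, hl⟩]
  exact R.isMinimal_first.monotone (Fin.mk_le_mk.mpr (by omega))

lemma sum_c (g : ℕ → ℚ) : ∑ j, g (R.c j) = ∑ j ∈ Finset.Icc 1 R.n, g (R.secondDegree j) := by
  rw [← Finset.Ico_add_one_right_eq_Icc, Finset.sum_Ico_eq_sum_range, Finset.sum_range]
  refine Finset.sum_congr rfl fun j _ => ?_
  rw [add_comm 1 (j : ℕ)]
  exact congrArg g (R.secondDegree_succ j).symm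

/-- The first two exponents are split off because `ε_j` pairs `c_j` with `d_{j+2}`. -/
lemma sum_deg (hm : R.m = R.n + 2) (g : ℕ → ℚ) : ∑ i, g (R.deg i) =
    g (R.exponent 1) + g (R.exponent 2) + ∑ j ∈ Finset.Icc 1 R.n, g (R.exponent (j + 2)) := by
  have h1 : ∑ i, g (R.deg i) = ∑ k ∈ Finset.range R.m, g (R.exponent (k + 1)) := by
    rw [Finset.sum_range]
    exact Finset.sum_congr rfl fun i _ => congrArg g (R.exponent_succ i).symm
  rw [h1, hm, Finset.sum_range_succ', Finset.sum_range_succ',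
    ← Finset.Ico_add_one_right_eq_Icc, Finset.sum_Ico_eq_sum_range, Nat.add_sub_cancel]
  rw [add_assoc, add_comm]
  congr 1
  · rw [add_comm]
  · refine Finset.sum_congr rfl fun k _ => ?_
    rw [show k + 1 + 1 + 1 = 1 + k + 2 by omega]

/-- The three numerical relations expressing that the Hilbert polynomial of the Jacobian algebra is
the constant `τ(C)`. -/
lemma hilbert_polynomial_relations (hd : 1 ≤ d) (hf : f.IsHomogeneous d) (hred : Squarefree f) :
    R.m = R.n + 2 ∧
    ∑ i, ((d : ℚ) - 1 + R.deg i) - ∑ j, (R.c j : ℚ) = 3 * ((d : ℚ) - 1) ∧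
    2 * (totalTjurina f : ℚ) = ∑ i, ((d : ℚ) - 1 + R.deg i) ^ 2 - ∑ j, (R.c j : ℚ) ^ 2 -
      3 * ((d : ℚ) - 1) ^ 2 := by
  obtain ⟨k₀, hk₀⟩ := exists_hilbert_eq_totalTjurina hd hf hred
  -- Beyond `K` no subtraction in the binomials is truncated and the Hilbert function is constant.
  set K := k₀ + (d - 1) + ∑ i, (d - 1 + R.deg i) + ∑ j, R.c j with hK
  have hK1 : ∀ i, d - 1 + R.deg i ≤ ∑ i, (d - 1 + R.deg i) := fun i =>
    Finset.single_le_sum (f := fun i => d - 1 + R.deg i) (fun _ _ => Nat.zero_le _)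
      (Finset.mem_univ i)
  have hK2 : ∀ j, R.c j ≤ ∑ j, R.c j := fun j =>
    Finset.single_le_sum (fun _ _ => Nat.zero_le _) (Finset.mem_univ j)
  have hdc : ((d - 1 : ℕ) : ℚ) = (d : ℚ) - 1 := by rw [Nat.cast_sub hd, Nat.cast_one]
  have key : ∀ D : ℕ, K ≤ D →
      (2 + R.n - R.m : ℚ) / 2 * (D : ℚ) ^ 2 +
      (6 - 6 * ((d : ℚ) - 1) + 3 * R.n - 2 * ∑ j, (R.c j : ℚ) - 3 * R.m +
        2 * ∑ i, ((d : ℚ) - 1 + R.deg i)) / 2 * D +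
      (2 * totalTjurina f + 3 * (((d : ℚ) - 1) ^ 2 - 3 * ((d : ℚ) - 1) + 2) +
        (∑ j, (R.c j : ℚ) ^ 2 - 3 * ∑ j, (R.c j : ℚ) + 2 * R.n) - 2 -
        (∑ i, ((d : ℚ) - 1 + R.deg i) ^ 2 - 3 * ∑ i, ((d : ℚ) - 1 + R.deg i) + 2 * R.m)) / 2 = 0 := by
    intro D hD
    have h1 : ∀ i, d - 1 + R.deg i ≤ D := fun i => by have := hK1 i; omega
    have h2 : ∀ j, R.c j ≤ D := fun j => by have := hK2 j; omega
    have h := R.hilbert_jacobianIdeal hf (D := D) (by omega) h1 h2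
    rw [hk₀ D (by omega)] at h
    have hq := congrArg (Nat.cast : ℕ → ℚ) h
    push_cast only [Nat.cast_add, Nat.cast_mul, Nat.cast_sum] at hq
    have e0 := cast_choose_sub (Nat.zero_le D)
    rw [Nat.sub_zero] at e0
    rw [sum_cast_choose_sub h1, sum_cast_choose_sub h2, cast_choose_sub (by omega : d - 1 ≤ D),
      e0] at hq
    simp only [Nat.cast_add, hdc] at hq
    push_cast at hq
    linear_combination hq
  obtain ⟨hA, hB, hC⟩ := coeffs_eq_zero_of_eventually key
  have hmn : (R.m : ℚ) = R.n + 2 := by linear_combination -2 * hA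
  refine ⟨by exact_mod_cast hmn, by linear_combination hB + 3 / 2 * hmn, ?_⟩
  linear_combination 2 * hC - 3 * hB - 5 / 2 * hmn

/-- The entries `g j' i` with `j' ≤ j` and `i ≥ j + 2` of the matrix of second syzygies vanish if
the degree of `g j` is too small. -/
lemma secondSyz_eq_zero {j j' : Fin R.n} {i k : Fin R.m} (hj : j' ≤ j) (hi : k ≤ i)
    (h : R.c j ≤ d - 1 + R.deg k) : R.secondSyz j' i = 0 := by
  by_contra h0
  obtain ⟨a, ha⟩ := ne_zero_iff.mp h0
  have h1 := R.isMinimal_second.homogeneous j' i a ha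
  have h2 := R.isMinimal_second.monotone hj
  have h3 := R.isMinimal_first.monotone hi
  -- Degrees leave room only for a constant entry, and relations among minimal generators have none.
  have h4 : a.degree = 0 := by omega
  rw [(Finsupp.degree_eq_zero_iff a).mp h4] at ha
  refine ha (R.constantCoeff_eq_zero_of_firstMap ?_ i)
  have h5 : R.secondSyz j' ∈ LinearMap.ker R.firstMap := by
    rw [← range_secondMap, secondMap, Fintype.range_linearCombination]
    exact Submodule.subset_span (Set.mem_range_self j')
  exact h5

/-- Here `j` counts from 0. If the inequality failed, second syzygies `0, …, j` would vanish from
coordinate `j + 2` on; with two unit vectors they would give `j + 3` independent vectors in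
`S^(j+2)`. -/
lemma lt_c (hm : R.m = R.n + 2) (j : Fin R.n) :
    d - 1 + R.deg ⟨j + 2, by omega⟩ < R.c j := by
  by_contra! hc
  have hj := j.2
  let s : Fin (j + 1) → Fin R.n := Fin.castLE (by omega)
  let b : Fin 2 → Fin R.m := Fin.castLE (by omega)
  let ρ : Fin (j + 2) → Fin R.m := Fin.castLE (by omega)
  have hlin : LinearIndependent S (Sum.elim (fun k i => R.secondSyz (s k) (ρ i))
      (fun k i => (Pi.single (b k) 1 : Fin R.m → S) (ρ i)) :
      Fin (j + 1) ⊕ Fin 2 → Fin (j + 2) → S) := by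
    rw [Fintype.linearIndependent_iff]
    intro g hg
    set v : Fin R.m → S := ∑ k, g (Sum.inl k) • R.secondSyz (s k) +
      ∑ k, g (Sum.inr k) • (Pi.single (b k) 1 : Fin R.m → S) with hv
    have hv0 : v = 0 := by
      ext1 i
      by_cases hi : (i : ℕ) < j + 2
      · have h := congrFun hg ⟨i, hi⟩
        rw [Fintype.sum_sum_type] at h
        have hρ : ρ ⟨i, hi⟩ = i := rfl
        simpa [hv, Finset.sum_apply, hρ] using h
      · have h1 : ∀ k, R.secondSyz (s k) i = 0 := fun k =>
          R.secondSyz_eq_zero (j := j) (k := ⟨j + 2, by omega⟩)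
            (Fin.le_def.mpr (Nat.lt_succ_iff.mp k.2)) (Fin.le_def.mpr (not_lt.mp hi)) hc
        have h2 : ∀ k, (Pi.single (b k) 1 : Fin R.m → S) i = 0 := fun k =>
          Pi.single_eq_of_ne (fun h => hi (by
            have hk := k.2
            have h3 : (i : ℕ) = k := congrArg Fin.val h
            omega)) _
        simp [hv, Finset.sum_apply, h1, h2]
    have hker : ∀ k, R.firstMap (R.secondSyz k) = 0 := fun k => by
      have h5 : R.secondSyz k ∈ LinearMap.ker R.firstMap := by
        rw [← range_secondMap, secondMap, Fintype.range_linearCombination]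
        exact Submodule.subset_span (Set.mem_range_self k)
      exact h5
    -- The first map kills the second syzygies, leaving a relation between the first two generators,
    -- which is trivial.
    have h1 := congrArg R.firstMap hv0
    rw [hv, map_zero, map_add, map_sum, map_sum, Fin.sum_univ_two] at h1
    simp only [map_smul, hker, smul_zero, Finset.sum_const_zero, zero_add, firstMap_single,
      one_smul] at h1
    have hb : b 0 ≠ b 1 := fun h => by simpa [b] using congrArg Fin.val h
    obtain ⟨h2, h3⟩ := R.eq_zero_of_smul_add_smul hb h1
    have h4 : ∑ k, g (Sum.inl k) • R.secondSyz (s k) = 0 := by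
      rw [hv, Fin.sum_univ_two, h2, h3] at hv0
      simpa using hv0
    have h5 := Fintype.linearIndependent_iff.mp
      (R.linearIndependent_secondSyz.comp s (Fin.castLE_injective _)) _ h4
    rintro (k | k)
    · exact h5 k
    · fin_cases k
      · exact h2
      · exact h3
  have := hlin.fintype_card_le_finrank
  simp only [Fintype.card_sum, Fintype.card_fin, Module.finrank_fin_fun] at this
  omega

lemma one_le_eps (hd : 1 ≤ d) (hm : R.m = R.n + 2) {j : ℕ} (hj : j ∈ Finset.Icc 1 R.n) :
    1 ≤ R.eps j := by
  obtain ⟨hj1, hj2⟩ := Finset.mem_Icc.mp hj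
  have h : d - 1 + R.deg ⟨j - 1 + 2, by omega⟩ < R.c ⟨j - 1, by omega⟩ :=
    R.lt_c hm ⟨j - 1, by omega⟩
  have e1 : R.secondDegree j = R.c ⟨j - 1, by omega⟩ := by
    rw [secondDegree, dif_pos ⟨hj1, hj2⟩]
  have e2 : R.exponent (j + 2) = R.deg ⟨j - 1 + 2, by omega⟩ := by
    rw [exponent, dif_pos ⟨by omega, by omega⟩]
    congr 2
    omega
  rw [eps, e1, e2]
  omega

lemma sum_eps (hd : 1 ≤ d) (hf : f.IsHomogeneous d) (hred : Squarefree f) :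
    ∑ j ∈ Finset.Icc 1 R.n, R.eps j = R.curveType := by
  obtain ⟨hm, hB, -⟩ := R.hilbert_polynomial_relations hd hf hred
  rw [R.sum_deg hm fun k => (d : ℚ) - 1 + k, R.sum_c fun k => k] at hB
  have h : ∑ j ∈ Finset.Icc 1 R.n, (R.eps j : ℚ) =
      ∑ j ∈ Finset.Icc 1 R.n, (R.secondDegree j : ℚ) -
        ∑ j ∈ Finset.Icc 1 R.n, ((d : ℚ) - 1 + R.exponent (j + 2)) := by
    rw [← Finset.sum_sub_distrib]
    refine Finset.sum_congr rfl fun j _ => ?_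
    rw [eps]
    push_cast
    ring
  have h' : ((∑ j ∈ Finset.Icc 1 R.n, R.eps j : ℤ) : ℚ) = (R.curveType : ℚ) := by
    rw [curveType]
    push_cast
    linear_combination h - hB
  exact_mod_cast h'

/-- The constant-term relation with `c_j = d - 1 + d_{j+2} + ε_j` expanded, where `∑ ε_j = t`
absorbs the cross terms. Doubling keeps it in `ℤ`. -/
lemma two_mul_tauMax_sub (hd : 1 ≤ d) (hf : f.IsHomogeneous d) (hred : Squarefree f) :
    2 * (tauMax d (R.exponent 1) - totalTjurina f) = R.curveType ^ 2 + R.curveType +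
      ∑ j ∈ Finset.Icc 1 R.n, (R.eps j ^ 2 - R.eps j) +
      2 * ∑ j ∈ Finset.Icc 1 R.n, R.eps j * ((R.exponent (j + 2) : ℤ) - R.exponent 2) := by
  obtain ⟨hm, -, hC⟩ := R.hilbert_polynomial_relations hd hf hred
  have ht : ∑ j ∈ Finset.Icc 1 R.n, (R.eps j : ℚ) = R.curveType := by
    exact_mod_cast R.sum_eps hd hf hred
  rw [R.sum_deg hm fun k => ((d : ℚ) - 1 + k) ^ 2, R.sum_c fun k => (k : ℚ) ^ 2] at hC
  have h : ∑ j ∈ Finset.Icc 1 R.n, (R.secondDegree j : ℚ) ^ 2 =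
      ∑ j ∈ Finset.Icc 1 R.n, ((d : ℚ) - 1 + R.exponent (j + 2)) ^ 2 +
        2 * ((d : ℚ) - 1) * ∑ j ∈ Finset.Icc 1 R.n, (R.eps j : ℚ) +
        2 * ∑ j ∈ Finset.Icc 1 R.n, (R.eps j : ℚ) * R.exponent (j + 2) +
        ∑ j ∈ Finset.Icc 1 R.n, (R.eps j : ℚ) ^ 2 := by
    rw [Finset.mul_sum, Finset.mul_sum, ← Finset.sum_add_distrib, ← Finset.sum_add_distrib,
      ← Finset.sum_add_distrib]
    refine Finset.sum_congr rfl fun j _ => ?_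
    rw [eps]
    push_cast
    ring
  have hq : ((2 * (tauMax d (R.exponent 1) - totalTjurina f) : ℤ) : ℚ) =
      ((R.curveType ^ 2 + R.curveType + ∑ j ∈ Finset.Icc 1 R.n, (R.eps j ^ 2 - R.eps j) +
      2 * ∑ j ∈ Finset.Icc 1 R.n, R.eps j * ((R.exponent (j + 2) : ℤ) - R.exponent 2) : ℤ) : ℚ) := by
    have hT : (R.curveType : ℚ) = R.exponent 1 + R.exponent 2 + 1 - d := by
      rw [curveType]
      push_cast
      ring
    rw [tauMax]
    push_cast
    simp only [mul_sub, Finset.sum_sub_distrib, ← Finset.sum_mul]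
    rw [ht] at h ⊢
    rw [h] at hC
    rw [hT] at hC ⊢
    linear_combination -hC
  exact_mod_cast hq

end MinimalResolution

end

end PlaneCurve

/-! ### The two formulas, the signs of their terms and the equality case. -/

theorem corollary5p2 (d : ℕ) (hd : 1 ≤ d) (f : MvPolynomial (Fin 3) ℂ)
    (hf : f.IsHomogeneous d) (hred : Squarefree f)
    (R : PlaneCurve.MinimalResolution f d)
    (t : ℤ) (ht : R.curveType = t) (ht1 : 1 ≤ t) :
    -- the resolution has the expected shape, and the `ε_j` form an ordered partition of `t`
    (R.m = R.n + 2 ∧ LinearIndependent (MvPolynomial (Fin 3) ℂ) R.secondSyz ∧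
      (∀ j ∈ Finset.Icc 1 R.n, 1 ≤ R.eps j) ∧ ∑ j ∈ Finset.Icc 1 R.n, R.eps j = t) ∧
    -- the formula for `τ_max - τ(C)`, with the sign of its terms
    ((PlaneCurve.tauMax d (R.exponent 1) : ℚ) - (PlaneCurve.totalTjurina f : ℚ) =
        ((t : ℚ) ^ 2 + t) / 2
          + (∑ j ∈ Finset.Icc 1 R.n, ((R.eps j : ℚ) ^ 2 - R.eps j)) / 2
          + ∑ j ∈ Finset.Icc 1 R.n,
              (R.eps j : ℚ) * ((R.exponent (j + 2) : ℚ) - R.exponent 2) ∧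
      0 < t ^ 2 + t ∧
      (∀ j ∈ Finset.Icc 1 R.n, 0 ≤ R.eps j ^ 2 - R.eps j) ∧
      (∀ j ∈ Finset.Icc 1 R.n,
        0 ≤ R.eps j * ((R.exponent (j + 2) : ℤ) - R.exponent 2)) ∧
      (PlaneCurve.totalTjurina f : ℤ) < PlaneCurve.tauMax d (R.exponent 1)) ∧
    -- the formula for `τ'_max - τ(C)`, with the sign of its additional terms, the resulting bound and its equality case
    (d ≤ 2 * R.exponent 1 →
      (PlaneCurve.tauMax' d (R.exponent 1) : ℚ) - (PlaneCurve.totalTjurina f : ℚ) =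
        ((t : ℚ) ^ 2 - ((t : ℚ) - ((R.exponent 2 : ℚ) - R.exponent 1)) ^ 2) / 2
          + ((∑ j ∈ Finset.Icc 1 R.n, ((R.eps j : ℚ) ^ 2 - R.eps j))
              + ((R.exponent 2 : ℚ) - R.exponent 1)) / 2
          + ∑ j ∈ Finset.Icc 1 R.n,
              (R.eps j : ℚ) * ((R.exponent (j + 2) : ℚ) - R.exponent 2) ∧
      0 ≤ t ^ 2 - (t - ((R.exponent 2 : ℤ) - R.exponent 1)) ^ 2 ∧
      0 ≤ (R.exponent 2 : ℤ) - R.exponent 1 ∧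
      (PlaneCurve.totalTjurina f : ℤ) ≤ PlaneCurve.tauMax' d (R.exponent 1) ∧
      ((PlaneCurve.totalTjurina f : ℤ) = PlaneCurve.tauMax' d (R.exponent 1) ↔
        (∀ i ∈ Finset.Icc 1 R.m, R.exponent i = R.exponent 1) ∧
        (∀ j ∈ Finset.Icc 1 R.n, R.eps j = 1) ∧
        R.m + d = 2 * R.exponent 1 + 3)) := by
  obtain ⟨hm, -, -⟩ := R.hilbert_polynomial_relations hd hf hred
  have hsum : ∑ j ∈ Finset.Icc 1 R.n, R.eps j = t := (R.sum_eps hd hf hred).trans ht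
  have heps : ∀ j ∈ Finset.Icc 1 R.n, 1 ≤ R.eps j := fun j hj => R.one_le_eps hd hm hj
  have h21 : (R.exponent 1 : ℤ) ≤ R.exponent 2 :=
    Nat.cast_le.mpr (R.exponent_mono le_rfl (by omega) (by omega))
  have hx : ∀ j ∈ Finset.Icc 1 R.n, (R.exponent 2 : ℤ) ≤ R.exponent (j + 2) := fun j hj => by
    have := Finset.mem_Icc.mp hj
    exact Nat.cast_le.mpr (R.exponent_mono (by omega) (by omega) (by omega))
  have hsq : ∀ j ∈ Finset.Icc 1 R.n, 0 ≤ R.eps j ^ 2 - R.eps j := fun j hj => by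
    nlinarith [heps j hj]
  have hmul : ∀ j ∈ Finset.Icc 1 R.n,
      0 ≤ R.eps j * ((R.exponent (j + 2) : ℤ) - R.exponent 2) := fun j hj =>
    mul_nonneg (by linarith [heps j hj]) (sub_nonneg.mpr (hx j hj))
  have hsq' := Finset.sum_nonneg hsq
  have hmul' := Finset.sum_nonneg hmul
  have htt : 0 < t ^ 2 + t := by positivity
  have key := R.two_mul_tauMax_sub hd hf hred
  rw [ht] at key
  have keyQ := congrArg (Int.cast : ℤ → ℚ) key
  push_cast at keyQ
  refine ⟨⟨hm, R.linearIndependent_secondSyz, heps, hsum⟩,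
    ⟨by linear_combination keyQ / 2, htt, hsq, hmul, by linarith⟩, fun h2 => ?_⟩
  have htv : (t : ℤ) = R.exponent 1 + R.exponent 2 + 1 - d := by
    rw [← ht, PlaneCurve.MinimalResolution.curveType]
  -- Here `s = 2d_1 + 1 - d`, so the binomial is `(s + 1) s / 2`, and `2d_1 ≥ d` means `s ≥ 1`.
  set s : ℤ := t - ((R.exponent 2 : ℤ) - R.exponent 1) with hs
  have hs1 : 1 ≤ s := by omega
  have hst : s ≤ t := by omega
  have hchoose : 2 * (((2 * R.exponent 1 + 2 - d).choose 2 : ℕ) : ℤ) = s ^ 2 + s := by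
    have h3 : (((2 * R.exponent 1 + 2 - d : ℕ)) : ℤ) = s + 1 := by omega
    have h4 : (((2 * R.exponent 1 + 2 - d).choose 2 : ℕ) : ℚ) =
        (((2 * R.exponent 1 + 2 - d : ℕ) : ℤ) : ℚ) *
          ((((2 * R.exponent 1 + 2 - d : ℕ) : ℤ) : ℚ) - 1) / 2 := by
      rw [Nat.cast_choose_two]
      push_cast
      ring
    rw [h3] at h4
    have h5 : ((2 * (((2 * R.exponent 1 + 2 - d).choose 2 : ℕ) : ℤ) : ℤ) : ℚ) =
        ((s ^ 2 + s : ℤ) : ℚ) := by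
      push_cast at h4 ⊢
      rw [h4]
      ring
    exact_mod_cast h5
  have key' : 2 * (PlaneCurve.tauMax' d (R.exponent 1) - PlaneCurve.totalTjurina f) =
      (t ^ 2 - s ^ 2) + ∑ j ∈ Finset.Icc 1 R.n, (R.eps j ^ 2 - R.eps j) +
      ((R.exponent 2 : ℤ) - R.exponent 1) +
      2 * ∑ j ∈ Finset.Icc 1 R.n, R.eps j * ((R.exponent (j + 2) : ℤ) - R.exponent 2) := by
    rw [PlaneCurve.tauMax']
    linear_combination key - hchoose - hs
  have hts : 0 ≤ t ^ 2 - s ^ 2 := by nlinarith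
  have keyQ' := congrArg (Int.cast : ℤ → ℚ) key'
  rw [hs] at keyQ'
  push_cast at keyQ'
  refine ⟨by linear_combination keyQ' / 2, hts, by linarith, by linarith, ?_, ?_⟩
  · intro heq
    -- Every term on the right of `key'` is nonnegative, so all of them vanish.
    have e1 : (R.exponent 2 : ℤ) = R.exponent 1 := by linarith
    have e2 : ∑ j ∈ Finset.Icc 1 R.n, (R.eps j ^ 2 - R.eps j) = 0 := by linarith
    have e3 : ∑ j ∈ Finset.Icc 1 R.n,
        R.eps j * ((R.exponent (j + 2) : ℤ) - R.exponent 2) = 0 := by linarith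
    have e2' : ∀ j ∈ Finset.Icc 1 R.n, R.eps j = 1 := fun j hj => by
      have h6 := (Finset.sum_eq_zero_iff_of_nonneg hsq).mp e2 j hj
      have h7 := heps j hj
      nlinarith
    have e3' : ∀ j ∈ Finset.Icc 1 R.n, R.exponent (j + 2) = R.exponent 1 := fun j hj => by
      have h6 := (Finset.sum_eq_zero_iff_of_nonneg hmul).mp e3 j hj
      rw [e2' j hj] at h6
      omega
    refine ⟨fun i hi => ?_, e2', ?_⟩
    · obtain ⟨hi1, hi2⟩ := Finset.mem_Icc.mp hi
      obtain rfl | rfl | ⟨j, rfl⟩ : i = 1 ∨ i = 2 ∨ ∃ j, i = j + 1 + 2 := by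
        by_cases h3 : 3 ≤ i
        · exact Or.inr (Or.inr ⟨i - 3, by omega⟩)
        · omega
      · rfl
      · exact_mod_cast e1
      · exact e3' (j + 1) (Finset.mem_Icc.mpr (by omega))
    -- With all `ε_j = 1` the partition gives `n = t = 2d_1 + 1 - d`, and `m = n + 2`.
    · rw [Finset.sum_congr rfl e2'] at hsum
      simp at hsum
      omega
  · rintro ⟨e1, e2, -⟩
    have h12 : (R.exponent 2 : ℤ) = R.exponent 1 := by
      rw [e1 2 (Finset.mem_Icc.mpr (by omega))]
    have e3 : ∑ j ∈ Finset.Icc 1 R.n, (R.eps j ^ 2 - R.eps j) = 0 :=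
      Finset.sum_eq_zero fun j hj => by rw [e2 j hj]; norm_num
    have e4 : ∑ j ∈ Finset.Icc 1 R.n,
        R.eps j * ((R.exponent (j + 2) : ℤ) - R.exponent 2) = 0 :=
      Finset.sum_eq_zero fun j hj => by
        have := Finset.mem_Icc.mp hj
        rw [e1 (j + 2) (Finset.mem_Icc.mpr (by omega)), h12, sub_self, mul_zero]
    have h8 : s = t := by omega
    rw [e3, e4, h12, h8] at key'
    linarith
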